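/- Let $\lambda,\alpha>0$. For a probability density $\theta$ on $\mathbb R$, let $\sum_k\delta_{(T_k,Y_k)}$ be a Poisson point process on $\mathbb R\times\mathbb R$ with intensity measure $\lambda\,dt\otimes\theta(y)\,dy$ (that is, the times $T_k$ form a homogeneous Poisson process with rate $\lambda$ and carry independent i.i.d. marks $Y_k$ with density $\theta$), and let $$X_t=\sum_{k:\,T_k\le t}Y_k\,e^{-\alpha(t-T_k)},\qquad t\in\mathbb R,$$ be the stationary exponential shot noise. For $K,L,m>0$ and $s>1/2$ let $$\Theta(K,L,s,m)=\Big\{\theta \text{ a probability density on }\mathbb R:\ \int|y|^{4+m}\theta(y)\,dy\le K,\ \int_{\mathbb R}(1+|u|^2)^s|\mathcal F\theta(u)|^2\,du\le L^2\Big\},\qquad \mathcal F\theta(u)=\int\theta(y)e^{-iyu}\,dy .$$ For two $\sigma$-algebras $\mathcal A,\mathcal B$ of events put $$\beta(\mathcal A,\mathcal B)=\tfrac12\sup\sum_{i,j}|\mathbb P(A_i\cap B_j)-\mathbb P(A_i)\mathbb P(B_j)|,$$ the supremum being over all finite partitions $(A_i)$, $(B_j)$ of the probability space into sets of $\mathcal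 A$ and of $\mathcal B$ respectively, and let $\beta^\theta_n=\sup_{t\in\mathbb N}\beta\big(\sigma(X_u:u\in\mathbb N,\,u\le t),\,\sigma(X_{n+u}:u\in\mathbb N,\,u\ge t)\big)$ (where $\mathbb N=\{0,1,2,\dots\}$) be the $\beta$-mixing coefficients of the sampled sequence $(X_i)_{i\in\mathbb N}$ when the marks have density $\theta$. **Theorem.** Let $\lambda,\alpha,K,L,m>0$ and $s>1/2$. There exist constants $C>0$ and $\rho\in(0,1)$, depending only on $\lambda,\alpha,K,L,s,m$, such that for all $n\ge1$ $$\sup_{\theta\in\Theta(K,L,s,m)}\beta^\theta_n\le C\rho^n<\infty .$$ -/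

import Mathlib

open MeasureTheory ProbabilityTheory
open scoped ENNReal

universe u

namespace ShotNoise

/-! ### Poisson point processes and the exponential shot noise -/

/-- The number of points `Z k ω`, `k ∈ ℤ`, that lie in `B`, i.e. the mass of `B` under the random
measure `∑ₖ δ_{Zₖ}`. -/
noncomputable def pointCount {Ω E : Type*} (Z : ℤ → Ω → E) (B : Set E) (ω : Ω) : ℕ∞ :=
  {k : ℤ | Z k ω ∈ B}.encard

/-- `∑ₖ δ_{Zₖ}` is a Poisson point process on `E` with intensity measure `μ`: the number of points
in a measurable set of finite intensity has a Poisson law with mean `μ B`, and the numbers of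
points in pairwise disjoint measurable sets are independent. -/
structure IsPoissonPointProcess {Ω E : Type*} [MeasurableSpace Ω] [MeasurableSpace E]
    (P : Measure Ω) (Z : ℤ → Ω → E) (μ : Measure E) : Prop where
  measurable : ∀ k, Measurable (Z k)
  poisson : ∀ B : Set E, MeasurableSet B → μ B < ∞ →
    P.map (pointCount Z B) = (poissonMeasure (μ B).toNNReal).map (Nat.cast : ℕ → ℕ∞)
  indep : ∀ (r : ℕ) (B : Fin r → Set E), (∀ i, MeasurableSet (B i)) →
    Pairwise (fun i j => Disjoint (B i) (B j)) → iIndepFun (fun i => pointCount Z (B i)) P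

/-- The intensity `λ dt ⊗ θ(y) dy` on `ℝ × ℝ` of a homogeneous Poisson process of times with
rate `lam`, independently marked by i.i.d. marks with density `θ`. -/
noncomputable def markedIntensity (lam : ℝ) (θ : ℝ → ℝ) : Measure (ℝ × ℝ) :=
  (ENNReal.ofReal lam • (volume : Measure ℝ)).prod
    ((volume : Measure ℝ).withDensity fun y => ENNReal.ofReal (θ y))

/-- The exponential impulse response `h(t) = e^{-αt} 1_{t ≥ 0}`. -/
noncomputable def impulseResponse (α t : ℝ) : ℝ :=
  if 0 ≤ t then Real.exp (-α * t) else 0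

/-- The exponential shot noise `X_t = ∑_{k : T_k ≤ t} Y_k h(t - T_k)`. -/
noncomputable def shotNoise {Ω : Type*} (α : ℝ) (T Y : ℤ → Ω → ℝ) (t : ℝ) (ω : Ω) : ℝ :=
  ∑' k : {k : ℤ // T k ω ≤ t}, Y k ω * impulseResponse α (t - T k ω)

/-! ### The smoothness class -/

/-- The Fourier transform `∫ θ(y) e^{-iyu} dy`. -/
noncomputable def fourierTransform (θ : ℝ → ℝ) (u : ℝ) : ℂ :=
  ∫ y : ℝ, (θ y : ℂ) * Complex.exp (-(Complex.I * y * u))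

/-- `θ` is a probability density function on `ℝ`. -/
structure IsDensity (θ : ℝ → ℝ) : Prop where
  measurable : Measurable θ
  nonneg : ∀ y, 0 ≤ θ y
  lintegral_eq_one : ∫⁻ y, ENNReal.ofReal (θ y) = 1

/-- The class `Θ(K, L, s, m)` of probability densities with `∫ |y|^{4+m} θ(y) dy ≤ K` and
`∫ (1+|u|²)^s |ℱθ(u)|² du ≤ L²`. -/
def smoothnessClass (K L s m : ℝ) : Set (ℝ → ℝ) :=
  {θ | IsDensity θ ∧
    ∫⁻ y, ENNReal.ofReal (|y| ^ (4 + m) * θ y) ≤ ENNReal.ofReal K ∧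
    ∫⁻ u, ENNReal.ofReal ((1 + |u| ^ 2) ^ s * ‖fourierTransform θ u‖ ^ 2)
      ≤ ENNReal.ofReal (L ^ 2)}

/-! ### β-mixing coefficients -/

/-- `A` is a finite partition of `Ω` into sets of the σ-algebra `𝒜` (empty pieces allowed). -/
structure IsFinPartition {Ω : Type*} (𝒜 : MeasurableSpace Ω) {r : ℕ} (A : Fin r → Set Ω) :
    Prop where
  measurableSet : ∀ i, MeasurableSet[𝒜] (A i)
  disjoint : Pairwise fun i j => Disjoint (A i) (A j)
  iUnion_eq : ⋃ i, A i = Set.univ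

/-- The coefficient `β(𝒜, ℬ) = ½ sup ∑_{i,j} |P(Aᵢ ∩ Bⱼ) - P(Aᵢ) P(Bⱼ)|`, the supremum over all
finite partitions `(Aᵢ)` in `𝒜` and `(Bⱼ)` in `ℬ`. -/
noncomputable def betaCoeff {Ω : Type*} [MeasurableSpace Ω] (P : Measure Ω)
    (𝒜 ℬ : MeasurableSpace Ω) : ℝ≥0∞ :=
  2⁻¹ * ⨆ (p : ℕ) (q : ℕ) (A : Fin p → Set Ω) (B : Fin q → Set Ω)
    (_ : IsFinPartition 𝒜 A) (_ : IsFinPartition ℬ B),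
      ∑ i, ∑ j, ENNReal.ofReal |P.real (A i ∩ B j) - P.real (A i) * P.real (B j)|

/-- The `n`-th β-mixing coefficient of a sequence `(Xᵢ)_{i ≥ 0}`, i.e.
`sup_t β(σ(X_u, u ≤ t), σ(X_{n+u}, u ≥ t))`. -/
noncomputable def betaMixing {Ω : Type*} [MeasurableSpace Ω] (P : Measure Ω)
    (X : ℕ → Ω → ℝ) (n : ℕ) : ℝ≥0∞ :=
  ⨆ t : ℕ, betaCoeff P
    (⨆ (u : ℕ) (_ : u ≤ t), MeasurableSpace.comap (X u) inferInstance)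
    (⨆ (u : ℕ) (_ : t ≤ u), MeasurableSpace.comap (X (n + u)) inferInstance)

end ShotNoise

/-! ### Fourier inversion almost everywhere -/

section Fourier

open FourierTransform SchwartzMap
open scoped ContDiff

variable {V : Type*} [NormedAddCommGroup V] [InnerProductSpace ℝ V] [MeasurableSpace V]
  [BorelSpace V] [FiniteDimensional ℝ V]

/-! The shot noise is autoregressive: for t ≤ a ≤ b and d ≥ 0, almost surely X_{b+d} =
e^{-αd}(e^{-α(b-t)} X_t + V) + H_d, where V comes from the points with time in (a, b] and H_d from
the other points after t (`ae_tsum_noiseKernel_eq`). The past up to t reaches the future after b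
only through the contracted value e^{-α(b-t)} X_t, to which V is added; V, the H_d and the past come
from disjoint regions, hence are independent. If the law of V moves little in total variation under
small translations, the future nearly forgets the past.

V is compound Poisson. With probability e^{-λ(b-a)} its window is empty, and this atom costs at most
2e^{-λ(b-a)}. The remaining part of the law is τ ∗ m with m the Lévy measure, and it inherits the
translation regularity of m; the mass of τ cancels that of m (`hasShiftBound_compound`). The
regularity of m is that of θ: translation in L¹ is γ-Hölder uniformly over the class
(`exists_translate_bound`), because s > 1/2 makes ℱθ integrable against a positive power of the
frequency, while the moment condition controls the tails. Marks in the window are shrunk by a factor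
at least e^{-α(b-a)}, which costs e^{αγ(b-a)}.

Take b - t = n and for the window the second half of the gap. The two errors are of order e^{-λn/2}
and e^{αγn/2} e^{-αγn} = e^{-αγn/2}, with a constant involving a uniform bound for E|X_t| from
Campbell's formula. `sum_abs_sub_mul_le` turns this into a bound on β by comparing the past with an
independent copy of it.

The Poisson process is given only through its counts in sets, so independence over regions,
Campbell's formula and the characteristic functions are derived from counts. -/

theorem integral_fourier_smul_eq_of_integrable {f g : V → ℂ} (hf : Integrable f)
    (hg : Integrable g) : ∫ ξ, 𝓕 f ξ • g ξ = ∫ x, f x • 𝓕 g x := by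
  simpa using! VectorFourier.integral_fourierIntegral_smul_eq_flip (L := innerₗ V)
    Real.continuous_fourierChar continuous_inner hf hg

theorem integral_fourierInv_smul_eq_of_integrable {f g : V → ℂ} (hf : Integrable f)
    (hg : Integrable g) : ∫ ξ, 𝓕⁻ f ξ • g ξ = ∫ x, f x • 𝓕⁻ g x := by
  rw [Real.fourierInv_eq_fourier_comp_neg f,
    integral_fourier_smul_eq_of_integrable hf.comp_neg hg,
    ← integral_neg_eq_self]
  simp [Real.fourierInv_eq_fourier_neg]

theorem continuous_fourierInv_of_integrable {f : V → ℂ} (hf : Integrable f) :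
    Continuous (𝓕⁻ f) := by
  have : Continuous (𝓕 f) := VectorFourier.fourierIntegral_continuous
    Real.continuous_fourierChar continuous_inner hf
  have h2 : 𝓕⁻ f = fun x => 𝓕 f (-x) := by
    ext x; exact Real.fourierInv_eq_fourier_neg f x
  rw [h2]
  fun_prop

/-- No continuity of `f` is assumed, so only almost everywhere equality can hold. Both sides are
tested against a smooth compactly supported function; duality moves the transforms onto it, where
Schwartz inversion applies. -/
theorem ae_eq_fourierInv_fourier {f : V → ℂ} (hf : Integrable f) (hf' : Integrable (𝓕 f)) :
    ∀ᵐ x, f x = 𝓕⁻ (𝓕 f) x := by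
  refine ae_eq_of_integral_contDiff_smul_eq hf.locallyIntegrable
    (continuous_fourierInv_of_integrable hf').locallyIntegrable fun g hg hgs => ?_
  have hg' : ContDiff ℝ ∞ (fun x => (g x : ℂ)) := Complex.ofRealCLM.contDiff.comp hg
  have hgs' : HasCompactSupport (fun x => (g x : ℂ)) := hgs.comp_left (g := Complex.ofReal) rfl
  let φ : 𝓢(V, ℂ) := hgs'.toSchwartzMap hg'
  have hφ : ∀ x, φ x = g x := fun x => rfl
  have h1 : ∫ x, f x • 𝓕 (⇑(𝓕⁻ φ : 𝓢(V, ℂ))) x = ∫ x, 𝓕 f x • (𝓕⁻ φ : 𝓢(V, ℂ)) x :=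
    (integral_fourier_smul_eq_of_integrable hf (𝓕⁻ φ : 𝓢(V, ℂ)).integrable).symm
  have h2 : ∫ x, 𝓕 f x • (𝓕⁻ φ : 𝓢(V, ℂ)) x = ∫ x, 𝓕⁻ (𝓕 f) x • φ x := by
    rw [fourierInv_coe]
    exact (integral_fourierInv_smul_eq_of_integrable hf' φ.integrable).symm
  have h3 : 𝓕 (⇑(𝓕⁻ φ : 𝓢(V, ℂ))) = ⇑φ := by
    rw [← fourier_coe, FourierTransform.fourier_fourierInv_eq]
  rw [h3, h2] at h1
  simpa [hφ, mul_comm] using h1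

end Fourier

namespace ShotNoise

open FourierTransform

/-! ### Translations of a density of the smoothness class -/

theorem IsDensity.integrable {θ : ℝ → ℝ} (hθ : IsDensity θ) : Integrable θ := by
  refine ⟨hθ.measurable.aestronglyMeasurable, ?_⟩
  rw [hasFiniteIntegral_iff_ofReal (Filter.Eventually.of_forall hθ.nonneg), hθ.lintegral_eq_one]
  exact ENNReal.one_lt_top

theorem fourier_eq_fourierTransform (θ : ℝ → ℝ) (v : ℝ) :
    𝓕 (fun y => (θ y : ℂ)) v = fourierTransform θ (2 * Real.pi * v) := by
  rw [Real.fourier_real_eq_integral_exp_smul, fourierTransform]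
  congr 1 with y
  rw [smul_eq_mul, mul_comm]
  congr 2
  push_cast
  ring

/-- Interpolates between the Lipschitz bound |x| and the trivial bound 2. -/
theorem norm_exp_I_sub_one_le {γ : ℝ} (h0 : 0 ≤ γ) (h1 : γ ≤ 1) (x : ℝ) :
    ‖Complex.exp (Complex.I * x) - 1‖ ≤ 2 * |x| ^ γ := by
  rcases le_total |x| 1 with hx | hx
  · have h2 : |x| ≤ |x| ^ γ := by
      rcases eq_or_lt_of_le (abs_nonneg x) with h | h
      · rw [← h]; positivity
      · simpa using Real.rpow_le_rpow_of_exponent_ge h hx h1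
    have := Real.norm_exp_I_mul_ofReal_sub_one_le (x := x)
    rw [Real.norm_eq_abs] at this
    have h3 : 0 ≤ |x| ^ γ := by positivity
    linarith
  · have h2 : 1 ≤ |x| ^ γ := Real.one_le_rpow hx h0
    calc ‖Complex.exp (Complex.I * x) - 1‖ ≤ ‖Complex.exp (Complex.I * x)‖ + ‖(1 : ℂ)‖ :=
          norm_sub_le _ _
      _ = 2 := by rw [Complex.norm_exp_I_mul_ofReal]; norm_num
      _ ≤ _ := by linarith

/-- Used with a = 2π to pass from the normalisation of `𝓕` to that of `fourierTransform`; the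
Jacobian is at most 1 and is dropped. -/
theorem lintegral_comp_mul_left_le {a : ℝ} (ha : 1 ≤ a) {f : ℝ → ℝ≥0∞} (hf : Measurable f) :
    ∫⁻ x, f (a * x) ≤ ∫⁻ x, f x := by
  rw [← lintegral_map hf (measurable_const_mul a), Real.map_volume_mul_left (by positivity),
    lintegral_smul_measure, smul_eq_mul]
  have : ENNReal.ofReal |a⁻¹| ≤ 1 := by
    rw [abs_of_nonneg (by positivity), ENNReal.ofReal_le_one]
    exact inv_le_one_of_one_le₀ ha
  exact mul_le_of_le_one_left' this

theorem measurable_fourierTransform {θ : ℝ → ℝ} (hθ : IsDensity θ) :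
    Measurable (fourierTransform θ) := by
  have h : StronglyMeasurable (fourierTransform θ) := by
    refine StronglyMeasurable.integral_prod_right' (ν := volume)
      (f := fun p : ℝ × ℝ => (θ p.2 : ℂ) * Complex.exp (-(Complex.I * p.2 * p.1))) ?_
    have := hθ.measurable
    exact Measurable.stronglyMeasurable (by fun_prop)
  exact h.measurable

/-- With p = 1 + u², the weighted transform is the product of p^{s/2}|ℱθ| and p^{(γ-s)/2}, and xy ≤
x² + y². The first square is the Sobolev integrand, the second is integrable because 2(s - γ) > 1.
-/
theorem lintegral_norm_fourier_mul_le {γ s L : ℝ} {θ : ℝ → ℝ} (hθ : IsDensity θ)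
    (h1 : γ < s - 1 / 2)
    (hL : ∫⁻ u, ENNReal.ofReal ((1 + |u| ^ 2) ^ s * ‖fourierTransform θ u‖ ^ 2)
      ≤ ENNReal.ofReal (L ^ 2)) :
    ∫⁻ v, ENNReal.ofReal (‖𝓕 (fun y => (θ y : ℂ)) v‖ * (1 + |2 * Real.pi * v| ^ 2) ^ (γ / 2))
      ≤ ENNReal.ofReal (L ^ 2 + ∫ u : ℝ, (1 + |u| ^ 2) ^ (γ - s)) := by
  have hm := measurable_fourierTransform hθ
  have hint : Integrable (fun u : ℝ => (1 + |u| ^ 2) ^ (γ - s)) := by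
    have := integrable_rpow_neg_one_add_norm_sq (E := ℝ) (μ := volume) (r := 2 * (s - γ))
      (by simp; linarith)
    convert! this using 3
    ring
  simp_rw [fourier_eq_fourierTransform]
  refine (lintegral_comp_mul_left_le (a := 2 * Real.pi) (by linarith [Real.pi_gt_three])
    (f := fun u => ENNReal.ofReal (‖fourierTransform θ u‖ * (1 + |u| ^ 2) ^ (γ / 2)))
    (by fun_prop)).trans ?_
  rw [ENNReal.ofReal_add (by positivity) (integral_nonneg fun u => by positivity),
    ofReal_integral_eq_lintegral_ofReal hint (Filter.Eventually.of_forall fun u => by positivity)]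
  refine le_trans ?_ (add_le_add_left hL _)
  rw [← lintegral_add_left (by fun_prop)]
  refine lintegral_mono fun u => ?_
  rw [← ENNReal.ofReal_add (by positivity) (by positivity)]
  refine ENNReal.ofReal_le_ofReal ?_
  have hp : 0 < 1 + |u| ^ 2 := by positivity
  set p := 1 + |u| ^ 2
  set F := ‖fourierTransform θ u‖
  have e1 : p ^ s = (p ^ (s / 2)) ^ 2 := by
    rw [← Real.rpow_natCast, ← Real.rpow_mul hp.le]; congr 1; push_cast; ring
  have e2 : p ^ (γ - s) = (p ^ ((γ - s) / 2)) ^ 2 := by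
    rw [← Real.rpow_natCast, ← Real.rpow_mul hp.le]; congr 1; push_cast; ring
  have e3 : p ^ (γ / 2) = p ^ (s / 2) * p ^ ((γ - s) / 2) := by
    rw [← Real.rpow_add hp]; congr 1; ring
  rw [e1, e2, e3]
  nlinarith [sq_nonneg (p ^ (s / 2) * F - p ^ ((γ - s) / 2)), sq_nonneg (p ^ (s / 2) * F),
    sq_nonneg (p ^ ((γ - s) / 2))]

theorem exists_holder_version {γ s L : ℝ} {θ : ℝ → ℝ} (hθ : IsDensity θ)
    (h0 : 0 ≤ γ) (hγ : γ ≤ 1) (h1 : γ < s - 1 / 2)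
    (hL : ∫⁻ u, ENNReal.ofReal ((1 + |u| ^ 2) ^ s * ‖fourierTransform θ u‖ ^ 2)
      ≤ ENNReal.ofReal (L ^ 2)) :
    ∃ g : ℝ → ℂ, (∀ᵐ y, (θ y : ℂ) = g y) ∧ ∀ x y,
      ‖g x - g y‖ ≤ 2 * (L ^ 2 + ∫ u : ℝ, (1 + |u| ^ 2) ^ (γ - s)) * |x - y| ^ γ := by
  set M := L ^ 2 + ∫ u : ℝ, (1 + |u| ^ 2) ^ (γ - s)
  have hM : 0 ≤ M := add_nonneg (by positivity) (integral_nonneg fun u => by positivity)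
  set F := 𝓕 (fun y => (θ y : ℂ)) with hF
  have hθi : Integrable (fun y => (θ y : ℂ)) := hθ.integrable.ofReal
  have hFc : Continuous F := VectorFourier.fourierIntegral_continuous
    Real.continuous_fourierChar continuous_inner hθi
  have hlin := lintegral_norm_fourier_mul_le hθ h1 hL
  rw [← hF] at hlin
  have hW : Integrable (fun v => ‖F v‖ * (1 + |2 * Real.pi * v| ^ 2) ^ (γ / 2)) := by
    refine ⟨Measurable.aestronglyMeasurable (by fun_prop), ?_⟩
    rw [hasFiniteIntegral_iff_ofReal (Filter.Eventually.of_forall fun u => by positivity)]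
    exact hlin.trans_lt ENNReal.ofReal_lt_top
  have hWM : ∫ v, ‖F v‖ * (1 + |2 * Real.pi * v| ^ 2) ^ (γ / 2) ≤ M := by
    rw [integral_eq_lintegral_of_nonneg_ae (Filter.Eventually.of_forall fun u => by positivity)
      hW.aestronglyMeasurable]
    exact ENNReal.toReal_le_of_le_ofReal hM hlin
  have hFi : Integrable F := by
    refine hW.mono' hFc.aestronglyMeasurable (Filter.Eventually.of_forall fun v => ?_)
    refine le_mul_of_one_le_right (norm_nonneg _) (Real.one_le_rpow ?_ (by linarith))
    nlinarith [sq_nonneg |2 * Real.pi * v|]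
  refine ⟨𝓕⁻ F, ae_eq_fourierInv_fourier hθi hFi, fun x y => ?_⟩
  have hexp : ∀ z : ℝ, 𝓕⁻ F z = ∫ v, Complex.exp (Complex.I * (2 * Real.pi * v * z : ℝ)) * F v := by
    intro z
    rw [Real.fourierInv_eq']
    congr 1 with v
    rw [smul_eq_mul]
    congr 2
    simp
    ring
  have hint : ∀ z : ℝ, Integrable fun v =>
      Complex.exp (Complex.I * (2 * Real.pi * v * z : ℝ)) * F v := by
    intro z
    refine hFi.mono (Measurable.aestronglyMeasurable (by fun_prop))
      (Filter.Eventually.of_forall fun v => ?_)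
    rw [norm_mul, Complex.norm_exp_I_mul_ofReal, one_mul]
  rw [hexp, hexp, ← integral_sub (hint x) (hint y)]
  calc ‖∫ v, (Complex.exp (Complex.I * (2 * Real.pi * v * x : ℝ)) * F v -
          Complex.exp (Complex.I * (2 * Real.pi * v * y : ℝ)) * F v)‖
      ≤ ∫ v, 2 * |x - y| ^ γ * (‖F v‖ * (1 + |2 * Real.pi * v| ^ 2) ^ (γ / 2)) := by
        refine norm_integral_le_of_norm_le (hW.const_mul _)
          (Filter.Eventually.of_forall fun v => ?_)
        have e : Complex.exp (Complex.I * (2 * Real.pi * v * x : ℝ)) * F v -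
            Complex.exp (Complex.I * (2 * Real.pi * v * y : ℝ)) * F v =
            Complex.exp (Complex.I * (2 * Real.pi * v * y : ℝ)) *
            (Complex.exp (Complex.I * (2 * Real.pi * v * (x - y) : ℝ)) - 1) * F v := by
          rw [mul_sub, ← Complex.exp_add, sub_mul, mul_one]
          congr 3
          push_cast
          ring
        rw [e, norm_mul, norm_mul, Complex.norm_exp_I_mul_ofReal, one_mul]
        have h2 := norm_exp_I_sub_one_le h0 hγ (2 * Real.pi * v * (x - y))
        have h3 : |2 * Real.pi * v * (x - y)| ^ γ ≤
            |x - y| ^ γ * (1 + |2 * Real.pi * v| ^ 2) ^ (γ / 2) := by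
          rw [abs_mul, Real.mul_rpow (abs_nonneg _) (abs_nonneg _), mul_comm]
          gcongr
          set q := |2 * Real.pi * v|
          have hq : 0 ≤ q := abs_nonneg _
          calc q ^ γ = (q ^ 2) ^ (γ / 2) := by
                rw [← Real.rpow_natCast, ← Real.rpow_mul hq]; congr 1; push_cast; ring
            _ ≤ _ := by gcongr; linarith
        calc _ ≤ 2 * (|x - y| ^ γ * (1 + |2 * Real.pi * v| ^ 2) ^ (γ / 2)) * ‖F v‖ := by
              gcongr; linarith
          _ = _ := by ring
    _ = 2 * |x - y| ^ γ * ∫ v, (‖F v‖ * (1 + |2 * Real.pi * v| ^ 2) ^ (γ / 2)) :=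
        integral_const_mul _ _
    _ ≤ 2 * |x - y| ^ γ * M := by gcongr
    _ = _ := by ring

theorem IsDensity.integral_eq_one {θ : ℝ → ℝ} (hθ : IsDensity θ) : ∫ y, θ y = 1 := by
  rw [integral_eq_lintegral_of_nonneg_ae (Filter.Eventually.of_forall hθ.nonneg)
    hθ.integrable.aestronglyMeasurable, hθ.lintegral_eq_one, ENNReal.toReal_one]

/-- Only this first moment of the marks enters the argument, through |y| ≤ 1 + |y|^{4+m}. -/
theorem lintegral_abs_mul_density_le {K m : ℝ} (hK : 0 ≤ K) (hm : 0 ≤ m) {θ : ℝ → ℝ}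
    (hθ : IsDensity θ)
    (hKm : ∫⁻ y, ENNReal.ofReal (|y| ^ (4 + m) * θ y) ≤ ENNReal.ofReal K) :
    ∫⁻ y, ENNReal.ofReal (|y| * θ y) ≤ ENNReal.ofReal (1 + K) := by
  have hmeas := hθ.measurable
  rw [ENNReal.ofReal_add zero_le_one hK, ENNReal.ofReal_one, ← hθ.lintegral_eq_one]
  refine le_trans ?_ (add_le_add_right hKm _)
  rw [← lintegral_add_left (by fun_prop)]
  refine lintegral_mono fun y => ?_
  have h0 := hθ.nonneg y
  rw [← ENNReal.ofReal_add h0 (by positivity)]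
  refine ENNReal.ofReal_le_ofReal ?_
  have : |y| ≤ 1 + |y| ^ (4 + m) := by
    rcases le_total |y| 1 with h | h
    · have : 0 ≤ |y| ^ (4 + m) := by positivity
      linarith
    · have := Real.rpow_le_rpow_of_exponent_le h (show 1 ≤ 4 + m by linarith)
      rw [Real.rpow_one] at this
      linarith
  nlinarith

theorem integrable_abs_mul_density {K m : ℝ} (hK : 0 ≤ K) (hm : 0 ≤ m) {θ : ℝ → ℝ}
    (hθ : IsDensity θ)
    (hKm : ∫⁻ y, ENNReal.ofReal (|y| ^ (4 + m) * θ y) ≤ ENNReal.ofReal K) :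
    Integrable (fun y => |y| * θ y) := by
  have hmeas := hθ.measurable
  refine ⟨by fun_prop, ?_⟩
  rw [hasFiniteIntegral_iff_ofReal
    (Filter.Eventually.of_forall fun y => mul_nonneg (abs_nonneg y) (hθ.nonneg y))]
  exact (lintegral_abs_mul_density_le hK hm hθ hKm).trans_lt ENNReal.ofReal_lt_top

theorem integral_abs_mul_density_le {K m : ℝ} (hK : 0 ≤ K) (hm : 0 ≤ m) {θ : ℝ → ℝ}
    (hθ : IsDensity θ)
    (hKm : ∫⁻ y, ENNReal.ofReal (|y| ^ (4 + m) * θ y) ≤ ENNReal.ofReal K) :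
    ∫ y, |y| * θ y ≤ 1 + K := by
  rw [integral_eq_lintegral_of_nonneg_ae
    (Filter.Eventually.of_forall fun y => mul_nonneg (abs_nonneg y) (hθ.nonneg y))
    (integrable_abs_mul_density hK hm hθ hKm).aestronglyMeasurable]
  exact ENNReal.toReal_le_of_le_ofReal (by linarith) (lintegral_abs_mul_density_le hK hm hθ hKm)

/-- A pointwise Hölder bound is integrable only over a bounded set, so it is used on [-1/r, 1/r],
and Markov's inequality with the first moment handles the complement. -/
theorem integral_abs_sub_translate_le_of_holder {γ M A h : ℝ} {θ : ℝ → ℝ} (hθ : IsDensity θ)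
    {g : ℝ → ℂ} (hg : ∀ᵐ y, (θ y : ℂ) = g y)
    (hgM : ∀ x y, ‖g x - g y‖ ≤ M * |x - y| ^ γ)
    (hi : Integrable (fun y => |y| * θ y)) (hA : ∫ y, |y| * θ y ≤ A) (h0 : h ≠ 0) (h1 : |h| ≤ 1) :
    ∫ y, |θ y - θ (y + h)| ≤ (2 * M + 2 * A + 1) * |h| ^ (γ / 2) := by
  -- This cutoff balances the two parts: the inside costs (2/r) M |h|^γ = 2Mr and the tails cost
  -- r(2A + 1). The exponent is halved in return.
  set r := |h| ^ (γ / 2) with hr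
  have hh : 0 < |h| := abs_pos.2 h0
  have hr0 : 0 < r := by positivity
  have hrr : r * r = |h| ^ γ := by rw [hr, ← Real.rpow_add hh]; congr 1; ring
  have hg' : ∀ᵐ y, (θ (y + h) : ℂ) = g (y + h) :=
    (measurePreserving_add_right volume h).quasiMeasurePreserving.ae hg
  have hθh : Integrable (fun y => θ (y + h)) := hθ.integrable.comp_add_right h
  have hi2' : Integrable (fun y => |y + h| * θ (y + h)) := hi.comp_add_right h
  have hi2 : Integrable (fun y => |y + h| * θ (y + h) + θ (y + h)) := hi2'.add hθh
  have hi3 : Integrable (fun y => |y| * θ y + (|y + h| * θ (y + h) + θ (y + h))) := hi.add hi2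
  have hind : Integrable ((Set.Icc (-r⁻¹) r⁻¹).indicator fun _ => M * |h| ^ γ) :=
    (integrable_indicator_iff measurableSet_Icc).2 (integrableOn_const (by simp))
  have hb : ∀ᵐ y, |θ y - θ (y + h)| ≤ (Set.Icc (-r⁻¹) r⁻¹).indicator (fun _ => M * |h| ^ γ) y +
      r * (|y| * θ y + (|y + h| * θ (y + h) + θ (y + h))) := by
    filter_upwards [hg, hg'] with y e1 e2
    have p1 := hθ.nonneg y
    have p2 := hθ.nonneg (y + h)
    have hrest : 0 ≤ r * (|y| * θ y + (|y + h| * θ (y + h) + θ (y + h))) := by positivity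
    by_cases hy : y ∈ Set.Icc (-r⁻¹) r⁻¹
    · rw [Set.indicator_of_mem hy]
      have : |θ y - θ (y + h)| = ‖g y - g (y + h)‖ := by
        rw [← e1, ← e2, ← Complex.ofReal_sub, Complex.norm_real, Real.norm_eq_abs]
      have h3 := hgM y (y + h)
      rw [show y - (y + h) = -h by ring, abs_neg] at h3
      linarith
    · rw [Set.indicator_of_notMem hy, zero_add]
      have hy' : r⁻¹ ≤ |y| := by
        by_contra hc
        push Not at hc
        exact hy (abs_le.1 hc.le)
      have hy2 : 1 ≤ r * |y| := by
        have := mul_le_mul_of_nonneg_left hy' hr0.le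
        rwa [mul_inv_cancel₀ hr0.ne'] at this
      have hy3 : |y| ≤ |y + h| + 1 := by
        calc |y| = |(y + h) - h| := by ring_nf
          _ ≤ |y + h| + |h| := abs_sub _ _
          _ ≤ _ := by linarith
      have hy4 : 1 ≤ r * (|y + h| + 1) := hy2.trans (by gcongr)
      calc |θ y - θ (y + h)| ≤ |θ y| + |θ (y + h)| := abs_sub _ _
        _ = θ y + θ (y + h) := by rw [abs_of_nonneg p1, abs_of_nonneg p2]
        _ ≤ (r * |y|) * θ y + (r * (|y + h| + 1)) * θ (y + h) := by
            gcongr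
            · exact le_mul_of_one_le_left p1 hy2
            · exact le_mul_of_one_le_left p2 hy4
        _ = _ := by ring
  calc ∫ y, |θ y - θ (y + h)|
      ≤ ∫ y, ((Set.Icc (-r⁻¹) r⁻¹).indicator (fun _ => M * |h| ^ γ) y +
          r * (|y| * θ y + (|y + h| * θ (y + h) + θ (y + h)))) :=
        integral_mono_ae (hθ.integrable.sub hθh).abs
          (hind.add (hi3.const_mul r)) hb
    _ = r⁻¹ * 2 * (M * |h| ^ γ) + r * ((∫ y, |y| * θ y) + ((∫ y, |y| * θ y) + 1)) := by
        rw [integral_add hind (hi3.const_mul r), integral_const_mul,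
          integral_add hi hi2, integral_add hi2' hθh,
          integral_add_right_eq_self (fun y => |y| * θ y), integral_add_right_eq_self θ,
          hθ.integral_eq_one, integral_indicator measurableSet_Icc]
        congr 1
        simp [Measure.real, Real.volume_Icc]
        left
        rw [ENNReal.toReal_ofReal (by positivity)]
        ring
    _ ≤ r⁻¹ * 2 * (M * |h| ^ γ) + r * (A + (A + 1)) := by gcongr
    _ = _ := by
        rw [← hrr]
        field_simp
        ring

theorem exists_translate_bound {K L s m : ℝ} (hK : 0 ≤ K) (hm : 0 ≤ m) (hs : 1 / 2 < s) :
    ∃ C γ : ℝ, 0 < C ∧ 0 < γ ∧ γ ≤ 1 ∧ ∀ θ ∈ smoothnessClass K L s m, ∀ a b : ℝ,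
      ∫ y, |θ (y - a) - θ (y - b)| ≤ C * |a - b| ^ γ := by
  -- This γ is the pointwise Hölder exponent; the exponent returned for the L¹ bound is γ/2.
  obtain ⟨γ, h0, h1⟩ : ∃ γ, 0 < γ ∧ γ < min 1 (s - 1 / 2) :=
    exists_between (by simp; linarith)
  have hγ1 : γ < 1 := h1.trans_le (min_le_left _ _)
  have hγs : γ < s - 1 / 2 := h1.trans_le (min_le_right _ _)
  set M := 2 * (L ^ 2 + ∫ u : ℝ, (1 + |u| ^ 2) ^ (γ - s)) with hMdef
  have hM : 0 ≤ M :=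
    mul_nonneg zero_le_two (add_nonneg (sq_nonneg L) (integral_nonneg fun u => by positivity))
  refine ⟨2 * M + 2 * (1 + K) + 1, γ / 2, by positivity, by positivity, by linarith, ?_⟩
  rintro θ ⟨hθ, hKm, hL⟩ a b
  obtain ⟨g, hg, hgM⟩ := exists_holder_version hθ h0.le hγ1.le hγs hL
  have e : ∫ y, |θ (y - a) - θ (y - b)| = ∫ y, |θ y - θ (y + (a - b))| := by
    rw [← integral_add_right_eq_self _ a]
    congr 1 with y
    congr 3
    · ring
    · ring
  rw [e]
  rcases eq_or_ne a b with rfl | hab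
  · simp
    positivity
  rcases le_total |a - b| 1 with h | h
  · exact integral_abs_sub_translate_le_of_holder hθ hg hgM
      (integrable_abs_mul_density hK hm hθ hKm) (integral_abs_mul_density_le hK hm hθ hKm)
      (sub_ne_zero.2 hab) h
  · have hθh : Integrable (fun y => θ (y + (a - b))) := hθ.integrable.comp_add_right _
    calc ∫ y, |θ y - θ (y + (a - b))| ≤ ∫ y, (θ y + θ (y + (a - b))) := by
          refine integral_mono (hθ.integrable.sub hθh).abs (hθ.integrable.add hθh) fun y => ?_
          refine (abs_sub _ _).trans_eq ?_
          rw [abs_of_nonneg (hθ.nonneg _), abs_of_nonneg (hθ.nonneg _)]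
      _ = 2 := by
          rw [integral_add hθ.integrable hθh, integral_add_right_eq_self θ, hθ.integral_eq_one]
          norm_num
      _ ≤ (2 * M + 2 * (1 + K) + 1) * 1 := by linarith
      _ ≤ _ := by
          gcongr
          exact Real.one_le_rpow h (by positivity)


/-! ### Sums over the points of a point process -/

section RandomMeasure

variable {Ω E : Type*} [MeasurableSpace E]

/-- The random measure `∑ₖ δ_{Zₖ}`. -/
noncomputable def randomMeasure (Z : ℤ → Ω → E) (ω : Ω) : Measure E :=
  Measure.sum fun k => Measure.dirac (Z k ω)

theorem randomMeasure_apply (Z : ℤ → Ω → E) (ω : Ω) {B : Set E} (hB : MeasurableSet B) :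
    randomMeasure Z ω B = (pointCount Z B ω : ℝ≥0∞) := by
  rw [randomMeasure, Measure.sum_apply _ hB, pointCount, ← ENNReal.tsum_set_one,
    tsum_subtype _ fun _ => (1 : ℝ≥0∞)]
  refine tsum_congr fun k => ?_
  rw [Measure.dirac_apply' _ hB]
  rfl

theorem lintegral_randomMeasure (Z : ℤ → Ω → E) (ω : Ω) {g : E → ℝ≥0∞} (hg : Measurable g) :
    ∫⁻ x, g x ∂randomMeasure Z ω = ∑' k, g (Z k ω) := by
  simp [randomMeasure, lintegral_sum_measure, lintegral_dirac' _ hg]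

theorem measurable_pointCount [MeasurableSpace Ω] {Z : ℤ → Ω → E} (hZ : ∀ k, Measurable (Z k))
    {B : Set E} (hB : MeasurableSet B) : Measurable (pointCount Z B) := by
  have h : Measurable fun ω => (pointCount Z B ω : ℝ≥0∞) := by
    simp_rw [← randomMeasure_apply Z _ hB, ← lintegral_indicator_one hB]
    have hm : Measurable (B.indicator (1 : E → ℝ≥0∞)) := measurable_one.indicator hB
    simp_rw [lintegral_randomMeasure Z _ hm]
    exact Measurable.tsum fun k => hm.comp (hZ k)
  refine measurable_to_countable' fun n => ?_
  have : pointCount Z B ⁻¹' {n} = (fun ω => (pointCount Z B ω : ℝ≥0∞)) ⁻¹' {(n : ℝ≥0∞)} := by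
    ext ω; simp
  rw [this]
  exact h (measurableSet_singleton _)

/-- The σ-algebra generated by the numbers of points in the measurable subsets of `R`. -/
@[reducible]
noncomputable def regionSigma (Z : ℤ → Ω → E) (R : Set E) : MeasurableSpace Ω :=
  MeasurableSpace.comap
    (fun ω (B : {B : Set E // MeasurableSet B ∧ B ⊆ R}) => pointCount Z B ω) MeasurableSpace.pi

theorem measurable_pointCount_regionSigma (Z : ℤ → Ω → E) {R B : Set E} (hB : MeasurableSet B)
    (hBR : B ⊆ R) : Measurable[regionSigma Z R] (pointCount Z B) := by
  have h := comap_measurable (m := MeasurableSpace.pi)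
    (fun ω (B : {B : Set E // MeasurableSet B ∧ B ⊆ R}) => pointCount Z B ω)
  exact (measurable_pi_apply (⟨B, hB, hBR⟩ : {B : Set E // MeasurableSet B ∧ B ⊆ R})).comp h

/-- The single points `Z k` need not be measurable for the σ-algebra of counts. The sum is, being
the integral of `g` against the restricted random measure, which the counts determine. -/
theorem measurable_regionSigma_ennreal_tsum (Z : ℤ → Ω → E) {R : Set E} (hR : MeasurableSet R)
    {g : E → ℝ≥0∞} (hg : Measurable g) (hgR : ∀ x ∉ R, g x = 0) :
    Measurable[regionSigma Z R] fun ω => ∑' k, g (Z k ω) := by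
  have h1 : Measurable[regionSigma Z R] fun ω => (randomMeasure Z ω).restrict R := by
    refine Measure.measurable_of_measurable_coe _ fun B hB => ?_
    simp_rw [Measure.restrict_apply hB, randomMeasure_apply Z _ (hB.inter hR)]
    have h2 := measurable_pointCount_regionSigma Z (hB.inter hR) (R := R) Set.inter_subset_right
    exact Measurable.comp (g := fun n : ℕ∞ => (n : ℝ≥0∞)) .of_discrete h2
  have h3 : (fun ω => ∑' k, g (Z k ω)) = fun ω => ∫⁻ x, g x ∂(randomMeasure Z ω).restrict R := by
    ext ω
    rw [← lintegral_randomMeasure Z ω hg, ← lintegral_indicator hR]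
    congr 1 with x
    by_cases hx : x ∈ R
    · simp [hx]
    · simp [hx, hgR x hx]
  rw [h3]
  exact (Measure.measurable_lintegral hg).comp h1

/-- Includes the value 0 that a non-summable family receives, so that measurability of signed sums
follows everywhere and not only almost surely. -/
theorem real_tsum_eq_toReal_sub (a : ℤ → ℝ) :
    ∑' k, a k = if ∑' k, ENNReal.ofReal |a k| = ∞ then 0 else
      (∑' k, ENNReal.ofReal (a k)).toReal - (∑' k, ENNReal.ofReal (-a k)).toReal := by
  have he : ∀ k, ENNReal.ofReal |a k| = ‖a k‖ₑ := fun k => by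
    rw [← ofReal_norm, Real.norm_eq_abs]
  simp_rw [he]
  split_ifs with h
  · refine tsum_eq_zero_of_not_summable fun hs => ?_
    exact tsum_enorm_ne_top_iff_summable_norm.2 hs.norm h
  · have hs : Summable fun k => |a k| := tsum_enorm_ne_top_iff_summable_norm.1 h
    have hp : Summable fun k => max (a k) 0 :=
      .of_nonneg_of_le (fun k => le_max_right _ _)
        (fun k => max_le (le_abs_self _) (abs_nonneg _)) hs
    have hn : Summable fun k => max (-a k) 0 :=
      .of_nonneg_of_le (fun k => le_max_right _ _)
        (fun k => max_le (neg_le_abs _) (abs_nonneg _)) hs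
    have e : ∀ b : ℤ → ℝ, (∑' k, ENNReal.ofReal (b k)).toReal = ∑' k, max (b k) 0 := by
      intro b
      rw [ENNReal.tsum_toReal_eq fun k => ENNReal.ofReal_ne_top]
      rfl
    rw [e, e, ← hp.tsum_sub hn]
    refine tsum_congr fun k => ?_
    rcases le_total (a k) 0 with h | h
    · rw [max_eq_right h, max_eq_left (by linarith)]; ring
    · rw [max_eq_left h, max_eq_right (by linarith)]; ring

theorem measurable_regionSigma_tsum (Z : ℤ → Ω → E) {R : Set E} (hR : MeasurableSet R)
    {f : E → ℝ} (hf : Measurable f) (hfR : ∀ x ∉ R, f x = 0) :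
    Measurable[regionSigma Z R] fun ω => ∑' k, f (Z k ω) := by
  have h1 := measurable_regionSigma_ennreal_tsum Z hR (g := fun x => ENNReal.ofReal |f x|)
    (by fun_prop) (fun x hx => by simp [hfR x hx])
  have h2 := measurable_regionSigma_ennreal_tsum Z hR (g := fun x => ENNReal.ofReal (f x))
    (by fun_prop) (fun x hx => by simp [hfR x hx])
  have h3 := measurable_regionSigma_ennreal_tsum Z hR (g := fun x => ENNReal.ofReal (-f x))
    (by fun_prop) (fun x hx => by simp [hfR x hx])
  simp_rw [real_tsum_eq_toReal_sub]
  exact Measurable.ite (h1 (measurableSet_singleton _)) measurable_const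
    (h2.ennreal_toReal.sub h3.ennreal_toReal)

theorem regionSigma_le [MeasurableSpace Ω] {Z : ℤ → Ω → E} (hZ : ∀ k, Measurable (Z k))
    (R : Set E) : regionSigma Z R ≤ ‹MeasurableSpace Ω› :=
  (measurable_pi_lambda _ fun B => measurable_pointCount hZ B.2.1).comap_le

theorem regionSigma_mono (Z : ℤ → Ω → E) {R S : Set E} (h : R ⊆ S) :
    regionSigma Z R ≤ regionSigma Z S :=
  Measurable.comap_le (@measurable_pi_lambda _ _ _ (regionSigma Z S) _ _ fun B =>
    measurable_pointCount_regionSigma Z B.2.1 (B.2.2.trans h))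

theorem pointCount_eq_sum (Z : ℤ → Ω → E) {ι : Type*} (s : Finset ι) {A : ι → Set E}
    (hA : ∀ i, MeasurableSet (A i)) (hd : Pairwise fun i j => Disjoint (A i) (A j)) {B : Set E}
    (hB : B = ⋃ i ∈ s, A i) (ω : Ω) : pointCount Z B ω = ∑ i ∈ s, pointCount Z (A i) ω := by
  have hBm : MeasurableSet B := hB ▸ s.measurableSet_biUnion fun i _ => hA i
  have h : (pointCount Z B ω : ℝ≥0∞) = ∑ i ∈ s, (pointCount Z (A i) ω : ℝ≥0∞) := by
    simp_rw [← randomMeasure_apply Z ω hBm, ← randomMeasure_apply Z ω (hA _)]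
    rw [hB, measure_biUnion_finset (fun i _ j _ hij => hd hij) fun i _ => hA i]
  have h' : ((∑ i ∈ s, pointCount Z (A i) ω : ℕ∞) : ℝ≥0∞) =
      ∑ i ∈ s, (pointCount Z (A i) ω : ℝ≥0∞) :=
    map_sum ENat.toENNRealRingHom _ _
  rw [← h'] at h
  exact_mod_cast h

end RandomMeasure

/-! ### Independence over disjoint regions and Campbell's formula -/

section Poisson

variable {Ω E : Type*} [MeasurableSpace Ω] [MeasurableSpace E] {P : Measure Ω}
  {Z : ℤ → Ω → E} {μ : Measure E}

theorem IsPoissonPointProcess.iIndepFun_pointCount (hZ : IsPoissonPointProcess P Z μ)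
    {ι : Type*} [Finite ι] {A : ι → Set E} (hA : ∀ i, MeasurableSet (A i))
    (hd : Pairwise fun i j => Disjoint (A i) (A j)) :
    iIndepFun (fun i => pointCount Z (A i)) P := by
  obtain ⟨r, ⟨e⟩⟩ := Finite.exists_equiv_fin ι
  have h := hZ.indep r (fun i => A (e.symm i)) (fun i => hA _)
    (fun i j hij => hd (e.symm.injective.ne hij))
  simpa using h.precomp e.injective

/-- It suffices to treat finite families of counts in each region. Their sets may overlap, but every
such count is a sum of counts over the atoms of the generated finite algebra, and all atoms from
both regions are pairwise disjoint. -/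
theorem IsPoissonPointProcess.indep_regionSigma [IsProbabilityMeasure P]
    (hZ : IsPoissonPointProcess P Z μ)
    {R S : Set E} (hR : MeasurableSet R) (hS : MeasurableSet S) (hRS : Disjoint R S) :
    Indep (regionSigma Z R) (regionSigma Z S) P := by
  classical
  refine (IndepFun_iff_Indep _ _ _).1 (IndepFun.process_indepFun_process
    (fun B => measurable_pointCount hZ.measurable B.2.1)
    (fun B => measurable_pointCount hZ.measurable B.2.1) fun I J => ?_)
  -- the atoms of the algebras generated by the finite families `I` and `J`
  let atom (R : Set E) (I : Finset {B : Set E // MeasurableSet B ∧ B ⊆ R}) (ε : I → Bool) : Set E :=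
    {x | x ∈ R ∧ ∀ B : I, x ∈ B.1.1 ↔ ε B = true}
  have hatom : ∀ (R : Set E) (_ : MeasurableSet R) (I) (ε), MeasurableSet (atom R I ε) := by
    intro R hR I ε
    have : atom R I ε = R ∩ ⋂ B : I, if ε B = true then B.1.1 else (B.1.1)ᶜ := by
      ext x
      simp only [atom, Set.mem_ofPred_eq, Set.mem_inter_iff, Set.mem_iInter]
      refine and_congr_right fun _ => forall_congr' fun B => ?_
      cases ε B <;> simp
    rw [this]
    refine hR.inter (MeasurableSet.iInter fun B => ?_)
    split_ifs
    · exact B.1.2.1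
    · exact B.1.2.1.compl
  have hadj : ∀ (R : Set E) (I), Pairwise fun ε ε' => Disjoint (atom R I ε) (atom R I ε') := by
    intro R I ε ε' hne
    refine Set.disjoint_left.2 fun x hx hx' => hne (funext fun B => ?_)
    have := (hx.2 B).symm.trans (hx'.2 B)
    exact Bool.eq_iff_iff.2 this
  have hunion : ∀ (R : Set E) (I : Finset {B : Set E // MeasurableSet B ∧ B ⊆ R}) (B : I),
      B.1.1 = ⋃ ε ∈ (Finset.univ.filter fun ε : I → Bool => ε B = true), atom R I ε := by
    intro R I B
    ext x
    simp only [Finset.mem_filter, Finset.mem_univ, true_and, Set.mem_iUnion, exists_prop]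
    constructor
    · intro hx
      refine ⟨fun C => decide (x ∈ C.1.1), by simpa using hx, B.1.2.2 hx, fun C => by simp⟩
    · rintro ⟨ε, hε, hx⟩
      exact (hx.2 B).2 hε
  let A : (I → Bool) ⊕ (J → Bool) → Set E := Sum.elim (atom R I) (atom S J)
  have hA : ∀ i, MeasurableSet (A i) := by
    rintro (ε | ε)
    · exact hatom R hR I ε
    · exact hatom S hS J ε
  have hAd : Pairwise fun i j => Disjoint (A i) (A j) := by
    rintro (ε | ε) (ε' | ε') hne
    · exact hadj R I fun h => hne (h ▸ rfl)
    · exact hRS.mono (fun x hx => hx.1) (fun x hx => hx.1)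
    · exact hRS.symm.mono (fun x hx => hx.1) (fun x hx => hx.1)
    · exact hadj S J fun h => hne (h ▸ rfl)
  have hind := (hZ.iIndepFun_pointCount hA hAd).indepFun_finset
    (Finset.univ.map Function.Embedding.inl) (Finset.univ.map Function.Embedding.inr)
    (by
      rw [Finset.disjoint_left]
      simp)
    (fun i => measurable_pointCount hZ.measurable (hA i))
  have hcomp := hind.comp
    (φ := fun x (B : I) => ∑ ε ∈ Finset.univ.filter (fun ε : I → Bool => ε B = true),
      x ⟨Sum.inl ε, by simp⟩)
    (ψ := fun x (B : J) => ∑ ε ∈ Finset.univ.filter (fun ε : J → Bool => ε B = true),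
      x ⟨Sum.inr ε, by simp⟩) .of_discrete .of_discrete
  convert! hcomp using 1
  · ext ω B
    exact pointCount_eq_sum Z _ (hatom R hR I) (hadj R I) (hunion R I B) ω
  · ext ω B
    exact pointCount_eq_sum Z _ (hatom S hS J) (hadj S J) (hunion S J B) ω

theorem lintegral_natCast_poissonMeasure (r : NNReal) :
    ∫⁻ n, (n : ℝ≥0∞) ∂(poissonMeasure r) = r := by
  have h : HasSum (fun n : ℕ => ((n : ℝ) * (Real.exp (-r) * r ^ n / n.factorial))) r := by
    rw [← hasSum_nat_add_iff' 1]
    have h1 := (hasSum_one_poissonMeasure r).mul_left (r : ℝ)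
    simp only [Finset.range_one, Finset.sum_singleton, Nat.cast_zero, zero_mul, sub_zero]
    convert! h1 using 1
    · ext n
      rw [Nat.factorial_succ]
      push_cast
      field_simp
      ring
    · ring
  have h2 : ∀ n : ℕ, 0 ≤ ((n : ℝ) * (Real.exp (-r) * r ^ n / n.factorial)) := fun n => by positivity
  calc ∫⁻ n, (n : ℝ≥0∞) ∂(poissonMeasure r)
      = ∑' n : ℕ, (n : ℝ≥0∞) * poissonMeasure r {n} := lintegral_countable' _
    _ = ∑' n : ℕ, ENNReal.ofReal ((n : ℝ) * (Real.exp (-r) * r ^ n / n.factorial)) := by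
        refine tsum_congr fun n => ?_
        rw [poissonMeasure_singleton, ENNReal.ofReal_mul (by positivity), ENNReal.ofReal_natCast]
    _ = ENNReal.ofReal r := by rw [← ENNReal.ofReal_tsum_of_nonneg h2 h.summable, h.tsum_eq]
    _ = r := ENNReal.ofReal_coe_nnreal

theorem IsPoissonPointProcess.lintegral_pointCount (hZ : IsPoissonPointProcess P Z μ) {B : Set E}
    (hB : MeasurableSet B) (hμ : μ B < ∞) : ∫⁻ ω, (pointCount Z B ω : ℝ≥0∞) ∂P = μ B := by
  have h := lintegral_map (μ := P) (f := fun n : ℕ∞ => (n : ℝ≥0∞)) .of_discrete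
    (measurable_pointCount hZ.measurable hB)
  rw [← h, hZ.poisson B hB hμ, lintegral_map .of_discrete .of_discrete]
  simp only [ENat.toENNReal_coe]
  rw [lintegral_natCast_poissonMeasure, ENNReal.coe_toNNReal hμ.ne]

/-- Campbell's formula for indicators: the expected count is the sum of the laws of the points.
Finite-intensity sets come from the Poisson mean, the others from a σ-finite exhaustion. -/
theorem IsPoissonPointProcess.sum_map_eq [SigmaFinite μ] (hZ : IsPoissonPointProcess P Z μ) :
    Measure.sum (fun k => P.map (Z k)) = μ := by
  have key : ∀ B, MeasurableSet B → μ B < ∞ → Measure.sum (fun k => P.map (Z k)) B = μ B := by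
    intro B hB hμ
    rw [← hZ.lintegral_pointCount hB hμ, Measure.sum_apply _ hB]
    simp_rw [← randomMeasure_apply Z _ hB, randomMeasure, Measure.sum_apply _ hB,
      Measure.dirac_apply' _ hB]
    have hm : ∀ k, Measurable fun ω => B.indicator (1 : E → ℝ≥0∞) (Z k ω) := fun k =>
      (measurable_one.indicator hB).comp (hZ.measurable k)
    rw [lintegral_tsum fun k => (hm k).aemeasurable]
    refine tsum_congr fun k => ?_
    rw [Measure.map_apply (hZ.measurable k) hB,
      ← lintegral_indicator_one (hZ.measurable k hB)]
    rfl
  ext B hB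
  have hu : B = ⋃ n, B ∩ spanningSets μ n := by
    rw [← Set.inter_iUnion, iUnion_spanningSets, Set.inter_univ]
  have hmono : Monotone fun n => B ∩ spanningSets μ n := fun i j hij =>
    Set.inter_subset_inter_right _ (monotone_spanningSets μ hij)
  rw [hu, hmono.measure_iUnion, hmono.measure_iUnion]
  congr 1 with n
  exact key _ (hB.inter (measurableSet_spanningSets μ n))
    ((measure_mono Set.inter_subset_right).trans_lt (measure_spanningSets_lt_top μ n))

theorem IsPoissonPointProcess.lintegral_tsum [SigmaFinite μ] (hZ : IsPoissonPointProcess P Z μ)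
    {g : E → ℝ≥0∞} (hg : Measurable g) : ∫⁻ ω, ∑' k, g (Z k ω) ∂P = ∫⁻ x, g x ∂μ := by
  have hm : ∀ k, Measurable fun ω => g (Z k ω) := fun k => hg.comp (hZ.measurable k)
  rw [MeasureTheory.lintegral_tsum fun k => (hm k).aemeasurable]
  conv_rhs => rw [← hZ.sum_map_eq, lintegral_sum_measure]
  exact tsum_congr fun k => (lintegral_map hg (hZ.measurable k)).symm

theorem IsPoissonPointProcess.ae_summable [SigmaFinite μ] (hZ : IsPoissonPointProcess P Z μ)
    {f : E → ℝ} (hf : Measurable f) (hfi : ∫⁻ x, ENNReal.ofReal |f x| ∂μ < ∞) :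
    ∀ᵐ ω ∂P, Summable fun k => f (Z k ω) := by
  have hg : Measurable fun x => ENNReal.ofReal |f x| := by fun_prop
  rw [← hZ.lintegral_tsum hg] at hfi
  filter_upwards [ae_lt_top (Measurable.tsum fun k => hg.comp (hZ.measurable k)) hfi.ne] with ω hω
  refine .of_enorm ?_
  simpa [← ofReal_norm] using! hω.ne

theorem IsPoissonPointProcess.lintegral_abs_tsum_le [SigmaFinite μ]
    (hZ : IsPoissonPointProcess P Z μ) {f : E → ℝ} (hf : Measurable f) :
    ∫⁻ ω, ENNReal.ofReal |∑' k, f (Z k ω)| ∂P ≤ ∫⁻ x, ENNReal.ofReal |f x| ∂μ := by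
  rw [← hZ.lintegral_tsum (g := fun x => ENNReal.ofReal |f x|) (by fun_prop)]
  refine lintegral_mono fun ω => ?_
  simp_rw [← Real.norm_eq_abs, ofReal_norm]
  exact enorm_tsum_le_tsum_enorm

end Poisson


/-! ### The characteristic function of a sum over the points of a Poisson process -/

section CharFun

open Filter Topology

variable {Ω E : Type*} [MeasurableSpace Ω] [MeasurableSpace E] {P : Measure Ω}
  {Z : ℤ → Ω → E} {μ : Measure E}

theorem IsPoissonPointProcess.ae_finite (hZ : IsPoissonPointProcess P Z μ) {A : Set E}
    (hA : MeasurableSet A) (hμ : μ A < ∞) : ∀ᵐ ω ∂P, {k | Z k ω ∈ A}.Finite := by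
  have h1 := hZ.lintegral_pointCount hA hμ
  have hm : Measurable fun ω => (pointCount Z A ω : ℝ≥0∞) :=
    Measurable.comp (g := fun n : ℕ∞ => (n : ℝ≥0∞)) .of_discrete
      (measurable_pointCount hZ.measurable hA)
  filter_upwards [ae_lt_top hm (h1 ▸ hμ.ne)] with ω hω
  rw [ENat.toENNReal_lt_top] at hω
  exact Set.encard_lt_top_iff.1 hω

theorem IsPoissonPointProcess.charFun_toNat (hZ : IsPoissonPointProcess P Z μ) {B : Set E}
    (hB : MeasurableSet B) (hμ : μ B < ∞) (u : ℝ) :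
    charFun (P.map fun ω => ((pointCount Z B ω).toNat : ℝ)) u =
      Complex.exp (μ.real B * (Complex.exp (u * Complex.I) - 1)) := by
  have h1 : P.map (fun ω => ((pointCount Z B ω).toNat : ℝ)) =
      (P.map (pointCount Z B)).map (fun n : ℕ∞ => (n.toNat : ℝ)) := by
    rw [Measure.map_map .of_discrete (measurable_pointCount hZ.measurable hB)]
    rfl
  have h2 : ((poissonMeasure (μ B).toNNReal).map (Nat.cast : ℕ → ℕ∞)).map
      (fun n : ℕ∞ => (n.toNat : ℝ)) =
      (poissonMeasure (μ B).toNNReal).map (Nat.cast : ℕ → ℝ) := by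
    rw [Measure.map_map .of_discrete .of_discrete]
    rfl
  rw [h1, hZ.poisson B hB hμ, h2, charFun_map_cast_poissonMeasure]
  rfl

/-- The level sets of `g` inside `A` are disjoint, so the sum is a linear combination of independent
Poisson counts and its characteristic function is a product. -/
theorem IsPoissonPointProcess.integral_exp_tsum_simpleFunc [IsProbabilityMeasure P]
    (hZ : IsPoissonPointProcess P Z μ)
    {A : Set E} (hA : MeasurableSet A) (hμ : μ A < ∞) (g : SimpleFunc E ℝ)
    (hg : ∀ x ∉ A, g x = 0) (u : ℝ) :
    ∫ ω, Complex.exp (u * (∑' k, g (Z k ω) : ℝ) * Complex.I) ∂P =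
      Complex.exp (∫ x in A, (Complex.exp (u * g x * Complex.I) - 1) ∂μ) := by
  classical
  have : Fact (μ A < ∞) := ⟨hμ⟩
  let B : g.range → Set E := fun a => g ⁻¹' {a.1} ∩ A
  have hB : ∀ a, MeasurableSet (B a) := fun a => (g.measurableSet_fiber _).inter hA
  have hBμ : ∀ a, μ (B a) < ∞ := fun a => (measure_mono Set.inter_subset_right).trans_lt hμ
  have hd : Pairwise fun a b => Disjoint (B a) (B b) := by
    intro a b hab
    refine Set.disjoint_left.2 fun x hx hx' => hab (Subtype.ext ?_)
    exact hx.1.symm.trans hx'.1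
  have hmeas : ∀ a, Measurable fun ω => ((pointCount Z (B a) ω).toNat : ℝ) := fun a =>
    Measurable.comp (g := fun n : ℕ∞ => (n.toNat : ℝ)) .of_discrete
      (measurable_pointCount hZ.measurable (hB a))
  have hind := (hZ.iIndepFun_pointCount hB hd).comp
    (fun a (n : ℕ∞) => a.1 * (n.toNat : ℝ)) (fun a => .of_discrete)
  have hchar := congrFun (hind.charFun_map_fun_sum_eq_prod
    (fun a => ((hmeas a).const_mul a.1).aemeasurable)) u
  have hsum : ∀ᵐ ω ∂P, ∑' k, g (Z k ω) =
      ∑ a : g.range, a.1 * ((pointCount Z (B a) ω).toNat : ℝ) := by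
    filter_upwards [hZ.ae_finite hA hμ] with ω hω
    have hs : Function.support (fun k => g (Z k ω)) ⊆ hω.toFinset := by
      intro k hk
      by_contra hk'
      exact hk (hg _ (by simpa using hk'))
    rw [tsum_eq_sum' hs, ← Finset.sum_fiberwise_of_maps_to
      (t := (Finset.univ : Finset g.range))
      (g := fun k => (⟨g (Z k ω), g.mem_range_self _⟩ : g.range)) (fun _ _ => Finset.mem_univ _)]
    refine Finset.sum_congr rfl fun a _ => ?_
    have hc : pointCount Z (B a) ω =
        (hω.toFinset.filter fun k => (⟨g (Z k ω), g.mem_range_self _⟩ : g.range) = a).card := by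
      rw [pointCount, ← Set.encard_coe_eq_coe_finsetCard]
      congr 1
      ext k
      simp [B, Subtype.ext_iff, and_comm]
    rw [hc, ENat.toNat_natCast, Finset.sum_congr rfl (g := fun _ => a.1)
      (fun k hk => congrArg Subtype.val (Finset.mem_filter.1 hk).2)]
    rw [Finset.sum_const, nsmul_eq_mul, mul_comm]
  have hL : ∫ ω, Complex.exp (u * (∑' k, g (Z k ω) : ℝ) * Complex.I) ∂P =
      charFun (P.map fun ω => ∑ a : g.range, a.1 * ((pointCount Z (B a) ω).toNat : ℝ)) u := by
    rw [charFun_apply_real, integral_map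
      (Finset.measurable_sum _ fun a _ => (hmeas a).const_mul a.1).aemeasurable
      (Measurable.aestronglyMeasurable (by fun_prop))]
    refine integral_congr_ae ?_
    filter_upwards [hsum] with ω hω
    rw [hω]
  have hR : ∫ x in A, (Complex.exp (u * g x * Complex.I) - 1) ∂μ =
      ∑ a : g.range, (μ.real (B a) : ℂ) * (Complex.exp (u * a.1 * Complex.I) - 1) := by
    have hgi : Integrable g (μ.restrict A) := g.integrable_of_isFiniteMeasure
    have h1 := SimpleFunc.map_integral (μ := μ.restrict A) g
      (fun a : ℝ => Complex.exp (u * a * Complex.I) - 1) hgi (by simp)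
    rw [SimpleFunc.integral_eq_integral _ (SimpleFunc.integrable_of_isFiniteMeasure _)] at h1
    simp only [SimpleFunc.map_apply] at h1
    rw [h1, ← Finset.sum_coe_sort]
    refine Finset.sum_congr rfl fun a _ => ?_
    rw [measureReal_restrict_apply (g.measurableSet_fiber _), Complex.real_smul]
  rw [hL]
  refine hchar.trans ?_
  rw [hR, Complex.exp_sum, Finset.prod_apply]
  refine Finset.prod_congr rfl fun a _ => ?_
  refine (charFun_map_mul_comp (hmeas a).aemeasurable a.1 u).trans ?_
  rw [hZ.charFun_toNat (hB a) (hBμ a)]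
  push_cast
  rw [mul_comm (a.1 : ℂ)]

/-- Approximation by simple functions vanishing off `A`. Almost surely only finitely many points lie
in `A`, so the sums converge; dominated convergence does the rest on both sides. -/
theorem IsPoissonPointProcess.charFun_tsum [IsProbabilityMeasure P]
    (hZ : IsPoissonPointProcess P Z μ)
    {A : Set E} (hA : MeasurableSet A) (hμ : μ A < ∞) {f : E → ℝ} (hf : Measurable f)
    (hfA : ∀ x ∉ A, f x = 0) (u : ℝ) :
    charFun (P.map fun ω => ∑' k, f (Z k ω)) u =
      Complex.exp (∫ x in A, (Complex.exp (u * f x * Complex.I) - 1) ∂μ) := by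
  have : Fact (μ A < ∞) := ⟨hμ⟩
  let g : ℕ → SimpleFunc E ℝ := SimpleFunc.approxOn f hf Set.univ 0 trivial
  have hg : ∀ x, Tendsto (fun n => g n x) atTop (𝓝 (f x)) := fun x =>
    SimpleFunc.tendsto_approxOn hf (Set.mem_univ 0) (by simp)
  have hgA : ∀ n, ∀ x ∉ A, g n x = 0 := by
    intro n x hx
    have := SimpleFunc.norm_approxOn_zero_le hf (s := Set.univ) trivial x n
    rw [hfA x hx] at this
    simpa using this
  have hms : ∀ {h : E → ℝ}, Measurable h → (∀ x ∉ A, h x = 0) →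
      Measurable fun ω => ∑' k, h (Z k ω) := fun hh hhA =>
    (measurable_regionSigma_tsum Z hA hh hhA).mono (regionSigma_le hZ.measurable A) le_rfl
  have hexp : ∀ x y : ℝ, ‖Complex.exp (x * y * Complex.I)‖ = 1 := fun x y => by
    rw [← Complex.ofReal_mul, Complex.norm_exp_ofReal_mul_I]
  have hlim1 : Tendsto (fun n => ∫ ω, Complex.exp (u * (∑' k, g n (Z k ω) : ℝ) * Complex.I) ∂P)
      atTop (𝓝 (∫ ω, Complex.exp (u * (∑' k, f (Z k ω) : ℝ) * Complex.I) ∂P)) := by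
    refine tendsto_integral_of_dominated_convergence (fun _ => 1) (fun n => ?_)
      (integrable_const _) (fun n => Eventually.of_forall fun ω => (hexp _ _).le) ?_
    · have := hms (g n).measurable (hgA n)
      exact Measurable.aestronglyMeasurable (by fun_prop)
    · filter_upwards [hZ.ae_finite hA hμ] with ω hω
      have hs : ∀ h : E → ℝ, (∀ x ∉ A, h x = 0) →
          ∑' k, h (Z k ω) = ∑ k ∈ hω.toFinset, h (Z k ω) := by
        intro h hh
        refine tsum_eq_sum' fun k hk => ?_
        by_contra hk'
        exact hk (hh _ (by simpa using hk'))
      simp_rw [hs _ (hgA _), hs _ hfA]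
      have ht : Tendsto (fun n => ∑ k ∈ hω.toFinset, g n (Z k ω)) atTop
          (𝓝 (∑ k ∈ hω.toFinset, f (Z k ω))) := tendsto_finsetSum _ fun k _ => hg _
      exact ((Continuous.tendsto (f := fun x : ℝ => Complex.exp (u * x * Complex.I))
        (by fun_prop) _).comp ht)
  have hlim2 : Tendsto (fun n => ∫ x in A, (Complex.exp (u * g n x * Complex.I) - 1) ∂μ)
      atTop (𝓝 (∫ x in A, (Complex.exp (u * f x * Complex.I) - 1) ∂μ)) := by
    refine tendsto_integral_of_dominated_convergence (fun _ => 2) (fun n => ?_)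
      (integrable_const _) (fun n => Eventually.of_forall fun x => ?_)
      (Eventually.of_forall fun x => ?_)
    · have := (g n).measurable
      exact Measurable.aestronglyMeasurable (by fun_prop)
    · refine (norm_sub_le _ _).trans ?_
      rw [hexp, norm_one]
      norm_num
    · exact ((Continuous.tendsto (f := fun x : ℝ => Complex.exp (u * x * Complex.I) - 1)
        (by fun_prop) _).comp (hg x))
  rw [charFun_apply_real, integral_map (hms hf hfA).aemeasurable
    (Measurable.aestronglyMeasurable (by fun_prop))]
  simp_rw [hZ.integral_exp_tsum_simpleFunc hA hμ (g _) (hgA _) u] at hlim1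
  exact tendsto_nhds_unique hlim1 ((Complex.continuous_exp.tendsto _).comp hlim2)

end CharFun

/-! ### Compound Poisson laws -/

section CompoundPoisson

variable (m : Measure ℝ)

/-- The `k`-fold convolution power of a measure on `ℝ`. -/
noncomputable def convPow : ℕ → Measure ℝ
  | 0 => Measure.dirac 0
  | k + 1 => convPow k ∗ m

instance [IsFiniteMeasure m] (k : ℕ) : IsFiniteMeasure (convPow m k) := by
  induction k with
  | zero => rw [convPow]; infer_instance
  | succ k ih => rw [convPow]; infer_instance

theorem charFun_convPow [IsFiniteMeasure m] (k : ℕ) (u : ℝ) :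
    charFun (convPow m k) u = charFun m u ^ k := by
  induction k with
  | zero => simp [convPow, charFun_dirac]
  | succ k ih => rw [convPow, charFun_conv, ih, pow_succ]

theorem measureReal_convPow_univ [IsFiniteMeasure m] (k : ℕ) :
    (convPow m k).real Set.univ = m.real Set.univ ^ k := by
  have h := charFun_convPow m k 0
  rw [charFun_zero, charFun_zero] at h
  exact_mod_cast h

/-- The measure `τ` such that `e^{-c} δ₀ + τ ∗ m`, where `c` is the mass of `m`, is the compound
Poisson law with Lévy measure `m`. -/
noncomputable def compoundTail : Measure ℝ :=
  Measure.sum fun k : ℕ =>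
    ENNReal.ofReal (Real.exp (-m.real Set.univ) / (k + 1).factorial) • convPow m k

variable [IsFiniteMeasure m]

/-- One factor z is kept apart: it becomes the factor m in τ ∗ m. -/
theorem hasSum_exp_sub_one (z : ℂ) :
    HasSum (fun k : ℕ => z ^ k / (k + 1).factorial * z) (Complex.exp z - 1) := by
  have h := (NormedSpace.expSeries_div_hasSum_exp z)
  rw [← Complex.exp_eq_exp_ℂ, ← hasSum_nat_add_iff' 1] at h
  convert! h using 1
  · ext k
    rw [pow_succ]
    ring
  · simp

/-- The mass of τ is (1 - e^{-c})/c, written as a product so that c = 0 is allowed and finiteness of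
τ need not be known beforehand. -/
theorem compoundTail_univ_mul :
    compoundTail m Set.univ * ENNReal.ofReal (m.real Set.univ) =
      ENNReal.ofReal (1 - Real.exp (-m.real Set.univ)) := by
  set c := m.real Set.univ with hc
  have hc0 : 0 ≤ c := measureReal_nonneg
  have h1 : HasSum (fun k : ℕ => Real.exp (-c) / (k + 1).factorial * c ^ k * c)
      (1 - Real.exp (-c)) := by
    have h : HasSum (fun k : ℕ => c ^ k / (k + 1).factorial * c) (Real.exp c - 1) := by
      have := hasSum_exp_sub_one (c : ℂ)
      exact_mod_cast this
    convert! h.mul_left (Real.exp (-c)) using 1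
    · ext k; ring
    · rw [mul_sub, ← Real.exp_add]; simp
  rw [compoundTail, Measure.sum_apply _ MeasurableSet.univ, ← ENNReal.tsum_mul_right, ← h1.tsum_eq,
    ENNReal.ofReal_tsum_of_nonneg (fun k => by positivity) h1.summable]
  refine tsum_congr fun k => ?_
  rw [Measure.smul_apply, smul_eq_mul, ENNReal.ofReal_mul (by positivity),
    ENNReal.ofReal_mul (by positivity), ← measureReal_convPow_univ, ofReal_measureReal,
    ofReal_measureReal]

instance isFiniteMeasure_compoundTail : IsFiniteMeasure (compoundTail m) := by
  -- For m = 0 the mass identity reads 0 = 0 after multiplication by c = 0 and says nothing about τ.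
  rcases eq_or_ne m 0 with hm | hm
  · subst hm
    have : compoundTail (0 : Measure ℝ) = Measure.dirac 0 := by
      ext B hB
      rw [compoundTail, Measure.sum_apply _ hB, tsum_eq_single 0]
      · simp [convPow]
      · intro k hk
        obtain ⟨j, rfl⟩ := Nat.exists_eq_succ_of_ne_zero hk
        simp [convPow]
    rw [this]
    infer_instance
  · refine ⟨?_⟩
    by_contra h
    have h2 := compoundTail_univ_mul m
    rw [not_lt_top_iff.1 h, ENNReal.top_mul (by simpa using hm)] at h2
    exact ENNReal.ofReal_ne_top h2.symm

theorem charFun_compoundTail_mul (u : ℝ) :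
    charFun (compoundTail m) u * charFun m u =
      Real.exp (-m.real Set.univ) * (Complex.exp (charFun m u) - 1) := by
  set c := m.real Set.univ with hc
  have hint : Integrable (fun x : ℝ => Complex.exp (u * x * Complex.I)) (compoundTail m) := by
    refine Integrable.of_bound (Measurable.aestronglyMeasurable (by fun_prop)) 1
      (Filter.Eventually.of_forall fun x => ?_)
    rw [← Complex.ofReal_mul, Complex.norm_exp_ofReal_mul_I]
  have h1 := (hasSum_integral_measure hint).mul_right (charFun m u)
  have h2 := (hasSum_exp_sub_one (charFun m u)).mul_left (Real.exp (-c) : ℂ)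
  rw [charFun_apply_real]
  refine h1.unique ?_
  convert! h2 using 1
  ext k
  rw [integral_smul_measure, ← charFun_apply_real, charFun_convPow,
    ENNReal.toReal_ofReal (by positivity), Complex.real_smul]
  push_cast
  ring

/-- This is e^{z-c} = e^{-c} + e^{-c}(e^z - 1) with z the transform of m, read back through
uniqueness of characteristic functions. -/
theorem eq_compound_of_charFun {κ : Measure ℝ} [IsFiniteMeasure κ]
    (h : ∀ u, charFun κ u = Complex.exp (charFun m u - m.real Set.univ)) :
    κ = ENNReal.ofReal (Real.exp (-m.real Set.univ)) • Measure.dirac 0 + compoundTail m ∗ m := by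
  have : IsFiniteMeasure (ENNReal.ofReal (Real.exp (-m.real Set.univ)) •
      Measure.dirac (0 : ℝ)) := Measure.smul_finite _ ENNReal.ofReal_ne_top
  refine Measure.ext_of_charFun (funext fun u => ?_)
  have hint : ∀ ν : Measure ℝ, IsFiniteMeasure ν →
      Integrable (fun x : ℝ => Complex.exp (u * x * Complex.I)) ν := by
    intro ν _
    refine Integrable.of_bound (Measurable.aestronglyMeasurable (by fun_prop)) 1
      (Filter.Eventually.of_forall fun x => ?_)
    rw [← Complex.ofReal_mul, Complex.norm_exp_ofReal_mul_I]
  rw [h, charFun_apply_real (μ := _ + _), integral_add_measure (hint _ inferInstance) (hint _ inferInstance),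
    ← charFun_apply_real (μ := compoundTail m ∗ m), charFun_conv, charFun_compoundTail_mul,
    integral_smul_measure, integral_dirac, ENNReal.toReal_ofReal (by positivity), sub_eq_add_neg,
    Complex.exp_add]
  simp
  ring

end CompoundPoisson


/-! ### Total variation distance between translates of a law -/

/-- For test functions bounded by one, the integrals against the translates of `κ` by `x` and `x'`
differ by at most `a + b |x - x'|^γ`. -/
def HasShiftBound (κ : Measure ℝ) (a b γ : ℝ) : Prop :=
  ∀ φ : ℝ → ℝ, Measurable φ → (∀ x, |φ x| ≤ 1) → ∀ x x',
    ∫ v, φ (x + v) ∂κ - ∫ v, φ (x' + v) ∂κ ≤ a + b * |x - x'| ^ γ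

theorem integrable_of_abs_le_one {X : Type*} [MeasurableSpace X] {ν : Measure X}
    [IsFiniteMeasure ν] {φ : X → ℝ} (hφ : Measurable φ) (h1 : ∀ x, |φ x| ≤ 1) :
    Integrable φ ν :=
  Integrable.of_bound hφ.aestronglyMeasurable 1 (Filter.Eventually.of_forall h1)

/-- The atom at 0 has no regularity and costs 2e^{-c}. In τ ∗ m the inner integral over m is smooth
for each value of the τ variable; it contributes a factor c, and the mass of τ times c is at most 1,
so the bound does not grow with c. -/
theorem hasShiftBound_compound (m : Measure ℝ) [IsFiniteMeasure m] {b γ : ℝ} (hb : 0 ≤ b)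
    (h : HasShiftBound m 0 (m.real Set.univ * b) γ) :
    HasShiftBound (ENNReal.ofReal (Real.exp (-m.real Set.univ)) • Measure.dirac 0 +
      compoundTail m ∗ m) (2 * Real.exp (-m.real Set.univ)) b γ := by
  intro φ hφ h1 x x'
  set c := m.real Set.univ with hc
  have : IsFiniteMeasure (ENNReal.ofReal (Real.exp (-c)) • Measure.dirac (0 : ℝ)) :=
    Measure.smul_finite _ ENNReal.ofReal_ne_top
  have hm : ∀ z, Measurable fun v => φ (z + v) := fun z => by fun_prop
  have e : ∀ z, ∫ v, φ (z + v) ∂(ENNReal.ofReal (Real.exp (-c)) • Measure.dirac 0 +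
      compoundTail m ∗ m) =
      Real.exp (-c) * φ z + ∫ w, ∫ v, φ (z + (w + v)) ∂m ∂compoundTail m := by
    intro z
    rw [integral_add_measure (integrable_of_abs_le_one (hm z) fun _ => h1 _)
      (integrable_of_abs_le_one (hm z) fun _ => h1 _),
      integral_conv (integrable_of_abs_le_one (hm z) fun _ => h1 _), integral_smul_measure,
      integral_dirac, ENNReal.toReal_ofReal (by positivity)]
    simp
  have hi : ∀ z, Integrable (fun w => ∫ v, φ (z + (w + v)) ∂m) (compoundTail m) := by
    intro z
    refine Integrable.of_bound (StronglyMeasurable.aestronglyMeasurable ?_) (1 * c)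
      (Filter.Eventually.of_forall fun w => ?_)
    · exact StronglyMeasurable.integral_prod_right' (f := fun p : ℝ × ℝ => φ (z + (p.1 + p.2)))
        (Measurable.stronglyMeasurable (by fun_prop))
    · exact norm_integral_le_of_norm_le_const (Filter.Eventually.of_forall fun v => h1 _)
  have hmass : (compoundTail m).real Set.univ * c ≤ 1 := by
    have h2 := congrArg ENNReal.toReal (compoundTail_univ_mul m)
    rw [ENNReal.toReal_mul, ENNReal.toReal_ofReal measureReal_nonneg, ENNReal.toReal_ofReal
      (by simp [measureReal_nonneg])] at h2
    have := Real.exp_pos (-c)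
    change (compoundTail m Set.univ).toReal * c ≤ 1
    linarith
  have htail : ∫ w, ∫ v, φ (x + (w + v)) ∂m ∂compoundTail m -
      ∫ w, ∫ v, φ (x' + (w + v)) ∂m ∂compoundTail m ≤ b * |x - x'| ^ γ := by
    rw [← integral_sub (hi x) (hi x')]
    calc ∫ w, (∫ v, φ (x + (w + v)) ∂m - ∫ v, φ (x' + (w + v)) ∂m) ∂compoundTail m
        ≤ ∫ _w, c * b * |x - x'| ^ γ ∂compoundTail m := by
          refine integral_mono ((hi x).sub (hi x')) (integrable_const _) fun w => ?_
          have := h φ hφ h1 (x + w) (x' + w)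
          simpa [add_assoc] using this
      _ = ((compoundTail m).real Set.univ * c) * (b * |x - x'| ^ γ) := by
          rw [integral_const, smul_eq_mul]
          ring
      _ ≤ 1 * (b * |x - x'| ^ γ) := by gcongr
      _ = _ := one_mul _
  rw [e, e]
  have hx := abs_le.1 (h1 x)
  have hx' := abs_le.1 (h1 x')
  nlinarith [Real.exp_pos (-c)]

/-! ### A coupling bound for the dependence of two finite partitions -/

section Coupling

variable {Ω Ξ : Type*} [MeasurableSpace Ω] [MeasurableSpace Ξ] {P : Measure Ω}
  [IsProbabilityMeasure P]

/-- Integrates out V and H with the past (I, W) frozen. Only W, not V or H, depends on the past, so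
the result is a function of I and W. -/
theorem integral_comp_eq_of_indep {p q : ℕ} {I : Ω → Fin p} {J : Ω → Fin q} {W V : Ω → ℝ}
    {H : Ω → Ξ} (hI : Measurable I) (hW : Measurable W) (hV : Measurable V) (hH : Measurable H)
    (hind : IndepFun (fun ω => (I ω, W ω)) (fun ω => (V ω, H ω)) P) (hVH : IndepFun V H P)
    {G : ℝ × Ξ → Fin q} (hG : Measurable G) (hJ : ∀ᵐ ω ∂P, J ω = G (W ω + V ω, H ω))
    (ε : Fin p → Fin q → ℝ) (hε : ∀ i j, |ε i j| ≤ 1) :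
    ∫ ω, ε (I ω) (J ω) ∂P =
      ∫ ω, ∫ h, ∫ v, ε (I ω) (G (W ω + v, h)) ∂P.map V ∂P.map H ∂P := by
  have hε' : Measurable fun p : Fin p × Fin q => ε p.1 p.2 := .of_discrete
  have e1 := (indepFun_iff_map_prod_eq_prod_map_map (hI.prodMk hW).aemeasurable
    (hV.prodMk hH).aemeasurable).1 hind
  have e2 := (indepFun_iff_map_prod_eq_prod_map_map hV.aemeasurable hH.aemeasurable).1 hVH
  have : IsProbabilityMeasure (P.map V) := Measure.isProbabilityMeasure_map hV.aemeasurable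
  have : IsProbabilityMeasure (P.map H) := Measure.isProbabilityMeasure_map hH.aemeasurable
  have : IsProbabilityMeasure (P.map fun ω => (I ω, W ω)) :=
    Measure.isProbabilityMeasure_map (hI.prodMk hW).aemeasurable
  have : IsProbabilityMeasure (P.map fun ω => (V ω, H ω)) :=
    Measure.isProbabilityMeasure_map (hV.prodMk hH).aemeasurable
  let F : (Fin p × ℝ) × (ℝ × Ξ) → ℝ := fun z => ε z.1.1 (G (z.1.2 + z.2.1, z.2.2))
  have hF : Measurable F :=
    hε'.comp (measurable_fst.fst.prodMk (hG.comp (by fun_prop)))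
  calc ∫ ω, ε (I ω) (J ω) ∂P = ∫ ω, F ((I ω, W ω), (V ω, H ω)) ∂P := by
        refine integral_congr_ae ?_
        filter_upwards [hJ] with ω hω
        rw [hω]
    _ = ∫ z, F z ∂(P.map fun ω => ((I ω, W ω), (V ω, H ω))) :=
        (integral_map ((hI.prodMk hW).prodMk (hV.prodMk hH)).aemeasurable
          hF.aestronglyMeasurable).symm
    _ = ∫ z, ∫ y, F (z, y) ∂(P.map fun ω => (V ω, H ω)) ∂(P.map fun ω => (I ω, W ω)) := by
        rw [e1, integral_prod _ (integrable_of_abs_le_one hF fun z => hε _ _)]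
    _ = ∫ ω, ∫ y, F ((I ω, W ω), y) ∂(P.map fun ω => (V ω, H ω)) ∂P := by
        refine integral_map (hI.prodMk hW).aemeasurable ?_
        exact (StronglyMeasurable.integral_prod_right' hF.stronglyMeasurable).aestronglyMeasurable
    _ = _ := by
        congr 1 with ω
        rw [e2, integral_prod_symm _ (integrable_of_abs_le_one (by fun_prop) fun z => hε _ _)]

theorem integral_comp_of_fintype {ι : Type*} [Fintype ι] [MeasurableSpace ι]
    [DiscreteMeasurableSpace ι] {J : Ω → ι} (hJ : Measurable J) (e : ι → ℝ) :
    ∫ ω, e (J ω) ∂P = ∑ j, e j * P.real (J ⁻¹' {j}) := by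
  have : IsProbabilityMeasure (P.map J) := Measure.isProbabilityMeasure_map hJ.aemeasurable
  rw [← integral_map hJ.aemeasurable (f := e) .of_discrete,
    integral_fintype (μ := P.map J) .of_finite]
  refine Finset.sum_congr rfl fun j _ => ?_
  rw [map_measureReal_apply hJ (measurableSet_singleton j), smul_eq_mul, mul_comm]

/-! ### Averages of a test function over the smoothing variable -/

section Smoothing

variable {κ : Measure ℝ} {χ : Measure Ξ} [IsProbabilityMeasure κ] [IsProbabilityMeasure χ]
  {g : ℝ × Ξ → ℝ}

theorem stronglyMeasurable_integral_shift (hg : Measurable g) :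
    StronglyMeasurable fun z : ℝ × Ξ => ∫ v, g (z.1 + v, z.2) ∂κ :=
  StronglyMeasurable.integral_prod_right'
    (f := fun z : (ℝ × Ξ) × ℝ => g (z.1.1 + z.2, z.1.2))
    (hg.comp (by fun_prop)).stronglyMeasurable

theorem norm_integral_shift_le {X : Type*} {g : ℝ × X → ℝ} (hg1 : ∀ y, |g y| ≤ 1) (w : ℝ)
    (h : X) :
    ‖∫ v, g (w + v, h) ∂κ‖ ≤ 1 := by
  simpa using norm_integral_le_of_norm_le_const (μ := κ)
    (f := fun v => g (w + v, h)) (Filter.Eventually.of_forall fun v => hg1 _)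

theorem measurable_integral_integral_shift (hg : Measurable g) :
    Measurable fun w => ∫ h, ∫ v, g (w + v, h) ∂κ ∂χ :=
  (StronglyMeasurable.integral_prod_right'
    (f := fun z : ℝ × Ξ => ∫ v, g (z.1 + v, z.2) ∂κ)
    (stronglyMeasurable_integral_shift hg)).measurable

theorem abs_integral_integral_shift_le (hg1 : ∀ y, |g y| ≤ 1) (w : ℝ) :
    |∫ h, ∫ v, g (w + v, h) ∂κ ∂χ| ≤ 1 := by
  simpa using norm_integral_le_of_norm_le_const (μ := χ)
    (f := fun h => ∫ v, g (w + v, h) ∂κ)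
    (Filter.Eventually.of_forall fun h => norm_integral_shift_le hg1 w h)

theorem HasShiftBound.integral_integral_shift_sub_le {a b γ : ℝ} (hκ : HasShiftBound κ a b γ)
    (hg : Measurable g) (hg1 : ∀ y, |g y| ≤ 1) (w w' : ℝ) :
    ∫ h, ∫ v, g (w + v, h) ∂κ ∂χ - ∫ h, ∫ v, g (w' + v, h) ∂κ ∂χ ≤ a + b * |w - w'| ^ γ := by
  have hii : ∀ w, Integrable (fun h => ∫ v, g (w + v, h) ∂κ) χ := fun w =>
    Integrable.of_bound ((stronglyMeasurable_integral_shift hg).comp_measurable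
      (measurable_const.prodMk measurable_id : Measurable fun h : Ξ => (w, h))).aestronglyMeasurable
      1 (Filter.Eventually.of_forall fun h => norm_integral_shift_le hg1 w h)
  rw [← integral_sub (hii w) (hii w')]
  calc ∫ h, (∫ v, g (w + v, h) ∂κ - ∫ v, g (w' + v, h) ∂κ) ∂χ
      ≤ ∫ _h, (a + b * |w - w'| ^ γ) ∂χ :=
        integral_mono ((hii w).sub (hii w')) (integrable_const _) fun h =>
          hκ (fun y => g (y, h)) (hg.comp (by fun_prop)) (fun y => hg1 _) w w'
    _ = _ := by simp

end Smoothing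

/-- After choosing signs, the joint probabilities give E Ψ(I, W) and the products of marginals give
E Ψ(I, W') with W' an independent copy of W. The shift bound for V controls Ψ(i, w) - Ψ(i, w')
uniformly in i. -/
theorem sum_abs_sub_mul_le {p q : ℕ} {I : Ω → Fin p} {J : Ω → Fin q} {W V : Ω → ℝ}
    {H : Ω → Ξ} (hI : Measurable I) (hJm : Measurable J) (hW : Measurable W) (hV : Measurable V)
    (hH : Measurable H)
    (hind : IndepFun (fun ω => (I ω, W ω)) (fun ω => (V ω, H ω)) P) (hVH : IndepFun V H P)
    {G : ℝ × Ξ → Fin q} (hG : Measurable G) (hJ : ∀ᵐ ω ∂P, J ω = G (W ω + V ω, H ω))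
    {a b γ : ℝ} (hκ : HasShiftBound (P.map V) a b γ)
    (hint : Integrable (fun z : Ω × Ω => a + b * |W z.1 - W z.2| ^ γ) (P.prod P)) :
    ∑ i, ∑ j, |P.real (I ⁻¹' {i} ∩ J ⁻¹' {j}) - P.real (I ⁻¹' {i}) * P.real (J ⁻¹' {j})| ≤
      ∫ z : Ω × Ω, (a + b * |W z.1 - W z.2| ^ γ) ∂(P.prod P) := by
  have : IsProbabilityMeasure (P.map V) := Measure.isProbabilityMeasure_map hV.aemeasurable
  have : IsProbabilityMeasure (P.map H) := Measure.isProbabilityMeasure_map hH.aemeasurable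
  obtain ⟨ε, hε, hεs⟩ : ∃ ε : Fin p → Fin q → ℝ, (∀ i j, |ε i j| ≤ 1) ∧ ∀ i j,
      |P.real (I ⁻¹' {i} ∩ J ⁻¹' {j}) - P.real (I ⁻¹' {i}) * P.real (J ⁻¹' {j})| =
      ε i j * (P.real (I ⁻¹' {i} ∩ J ⁻¹' {j}) - P.real (I ⁻¹' {i}) * P.real (J ⁻¹' {j})) := by
    refine ⟨fun i j => SignType.sign
      (P.real (I ⁻¹' {i} ∩ J ⁻¹' {j}) - P.real (I ⁻¹' {i}) * P.real (J ⁻¹' {j})),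
      fun i j => ?_, fun i j => (sign_mul_self _).symm⟩
    rcases SignType.trichotomy (SignType.sign
      (P.real (I ⁻¹' {i} ∩ J ⁻¹' {j}) - P.real (I ⁻¹' {i}) * P.real (J ⁻¹' {j}))) with h | h | h <;>
    simp [h]
  have hεG : ∀ i, Measurable fun y : ℝ × Ξ => ε i (G y) := fun i =>
    Measurable.comp (g := fun j => ε i j) .of_discrete hG
  -- Ψ i w is the expectation of ε i J when W is replaced by the constant w.
  obtain ⟨Ψ, hΨdef⟩ : ∃ Ψ : Fin p → ℝ → ℝ,
      ∀ i w, Ψ i w = ∫ h, ∫ v, ε i (G (w + v, h)) ∂P.map V ∂P.map H := ⟨_, fun _ _ => rfl⟩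
  have hΨ : ∀ i, Measurable (Ψ i) := fun i => by
    rw [funext (hΨdef i)]
    exact measurable_integral_integral_shift (hεG i)
  have hΨ1 : ∀ i w, |Ψ i w| ≤ 1 := fun i w => by
    rw [hΨdef]
    exact abs_integral_integral_shift_le (g := fun y => ε i (G y)) (fun y => hε _ _) w
  have hΨsub : ∀ i w w', Ψ i w - Ψ i w' ≤ a + b * |w - w'| ^ γ := fun i w w' => by
    rw [hΨdef, hΨdef]
    exact hκ.integral_integral_shift_sub_le (hεG i) (fun y => hε _ _) w w'
  have hΨI : Measurable fun z : Fin p × ℝ => Ψ z.1 z.2 := measurable_from_prod_countable_right hΨ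
  have hjoint : ∑ i, ∑ j, ε i j * P.real (I ⁻¹' {i} ∩ J ⁻¹' {j}) = ∫ ω, Ψ (I ω) (W ω) ∂P := by
    simp_rw [hΨdef]
    rw [← integral_comp_eq_of_indep hI hW hV hH hind hVH hG hJ ε hε,
      integral_comp_of_fintype (hI.prodMk hJm) (fun z : Fin p × Fin q => ε z.1 z.2),
      Fintype.sum_prod_type]
    refine Finset.sum_congr rfl fun i _ => Finset.sum_congr rfl fun j _ => ?_
    congr 2
    ext ω
    simp
  -- The same identity with the row i of ε held fixed, so that I plays no role and only the law of J
  -- is seen.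
  have hmarg : ∀ i, ∑ j, ε i j * P.real (J ⁻¹' {j}) = ∫ ω, Ψ i (W ω) ∂P := fun i => by
    simp_rw [hΨdef]
    rw [← integral_comp_of_fintype hJm]
    exact integral_comp_eq_of_indep hI hW hV hH hind hVH hG hJ (fun _ j => ε i j)
      (fun _ j => hε i j)
  have hprod : ∑ i, ∑ j, ε i j * (P.real (I ⁻¹' {i}) * P.real (J ⁻¹' {j})) =
      ∫ ω, ∫ ω', Ψ (I ω) (W ω') ∂P ∂P := by
    rw [integral_comp_of_fintype hI (fun i => ∫ ω', Ψ i (W ω') ∂P)]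
    refine Finset.sum_congr rfl fun i _ => ?_
    rw [← hmarg, Finset.sum_mul]
    exact Finset.sum_congr rfl fun j _ => by ring
  have hi1 : Integrable (fun z : Ω × Ω => Ψ (I z.1) (W z.1)) (P.prod P) :=
    integrable_of_abs_le_one (hΨI.comp (by fun_prop : Measurable fun z : Ω × Ω => (I z.1, W z.1)))
      fun _ => hΨ1 _ _
  have hi2 : Integrable (fun z : Ω × Ω => Ψ (I z.1) (W z.2)) (P.prod P) :=
    integrable_of_abs_le_one (hΨI.comp (by fun_prop : Measurable fun z : Ω × Ω => (I z.1, W z.2)))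
      fun _ => hΨ1 _ _
  calc ∑ i, ∑ j, |P.real (I ⁻¹' {i} ∩ J ⁻¹' {j}) - P.real (I ⁻¹' {i}) * P.real (J ⁻¹' {j})|
      = ∑ i, ∑ j, (ε i j * P.real (I ⁻¹' {i} ∩ J ⁻¹' {j}) -
          ε i j * (P.real (I ⁻¹' {i}) * P.real (J ⁻¹' {j}))) := by
        refine Finset.sum_congr rfl fun i _ => Finset.sum_congr rfl fun j _ => ?_
        rw [← mul_sub, hεs]
    _ = ∫ ω, Ψ (I ω) (W ω) ∂P - ∫ ω, ∫ ω', Ψ (I ω) (W ω') ∂P ∂P := by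
        simp_rw [Finset.sum_sub_distrib]
        rw [hjoint, hprod]
    _ = ∫ z : Ω × Ω, (Ψ (I z.1) (W z.1) - Ψ (I z.1) (W z.2)) ∂(P.prod P) := by
        rw [integral_sub hi1 hi2, integral_prod _ hi1, integral_prod _ hi2]
        simp
    _ ≤ _ := integral_mono (hi1.sub hi2) hint fun z => hΨsub _ _ _

/-- Codes a partition as a random index, so that partition sums become expectations. -/
theorem IsFinPartition.exists_index {Ω : Type*} {𝒜 : MeasurableSpace Ω} {p : ℕ}
    {A : Fin p → Set Ω} (hA : IsFinPartition 𝒜 A) :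
    ∃ I : Ω → Fin p, Measurable[𝒜] I ∧ ∀ i, A i = I ⁻¹' {i} := by
  have h : ∀ ω, ∃ i, ω ∈ A i := fun ω => by
    have : ω ∈ ⋃ i, A i := hA.iUnion_eq ▸ Set.mem_univ ω
    simpa using this
  choose I hI using h
  have hAI : ∀ i, A i = I ⁻¹' {i} := by
    intro i
    ext ω
    constructor
    · intro hω
      by_contra hne
      exact Set.disjoint_left.1 (hA.disjoint hne) (hI ω) hω
    · rintro rfl
      exact hI ω
  exact ⟨I, @measurable_to_countable' _ _ _ _ 𝒜 _ fun i => hAI i ▸ hA.measurableSet i, hAI⟩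

end Coupling


/-! ### The exponential shot noise -/

/-- The contribution `y e^{-α(t-τ)} 1_{τ ≤ t}` at time `t` of a point `(τ, y)`. -/
noncomputable def noiseKernel (α t : ℝ) (p : ℝ × ℝ) : ℝ :=
  p.2 * impulseResponse α (t - p.1)

theorem measurable_impulseResponse (α : ℝ) : Measurable (impulseResponse α) :=
  Measurable.ite measurableSet_Ici (by fun_prop) measurable_const

theorem measurable_noiseKernel (α t : ℝ) : Measurable (noiseKernel α t) := by
  have := measurable_impulseResponse α
  unfold noiseKernel
  fun_prop

theorem noiseKernel_of_lt {α t : ℝ} {p : ℝ × ℝ} (h : t < p.1) : noiseKernel α t p = 0 := by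
  rw [noiseKernel, impulseResponse, if_neg (by linarith), mul_zero]

theorem noiseKernel_of_le {α t : ℝ} {p : ℝ × ℝ} (h : p.1 ≤ t) :
    noiseKernel α t p = p.2 * Real.exp (-α * (t - p.1)) := by
  rw [noiseKernel, impulseResponse, if_pos (by linarith)]

theorem noiseKernel_add {α t d : ℝ} (hd : 0 ≤ d) {p : ℝ × ℝ} (h : p.1 ≤ t) :
    noiseKernel α (t + d) p = Real.exp (-α * d) * noiseKernel α t p := by
  rw [noiseKernel_of_le h, noiseKernel_of_le (by linarith), mul_left_comm, ← Real.exp_add]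
  congr 2
  ring

theorem shotNoise_eq_tsum {Ω : Type*} (α : ℝ) (T Y : ℤ → Ω → ℝ) (t : ℝ) (ω : Ω) :
    shotNoise α T Y t ω = ∑' k, noiseKernel α t (T k ω, Y k ω) := by
  refine (tsum_subtype {k : ℤ | T k ω ≤ t}
    (fun k => Y k ω * impulseResponse α (t - T k ω))).trans ?_
  refine tsum_congr fun k => ?_
  by_cases h : T k ω ≤ t
  · rw [Set.indicator_of_mem (by exact h)]
    rfl
  · rw [Set.indicator_of_notMem (by exact h), noiseKernel_of_lt (by simpa using h)]

/-! ### Moments and translation bounds under the marked intensity -/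

section Intensity

variable {lam α : ℝ} {θ : ℝ → ℝ}

theorem IsDensity.isProbabilityMeasure (hθ : IsDensity θ) :
    IsProbabilityMeasure ((volume : Measure ℝ).withDensity fun y => ENNReal.ofReal (θ y)) :=
  ⟨by rw [withDensity_apply _ MeasurableSet.univ, Measure.restrict_univ, hθ.lintegral_eq_one]⟩

theorem IsDensity.integral_withDensity (hθ : IsDensity θ) (φ : ℝ → ℝ) :
    ∫ y, φ y ∂((volume : Measure ℝ).withDensity fun y => ENNReal.ofReal (θ y)) =
      ∫ y, θ y * φ y := by
  have hm := hθ.measurable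
  rw [integral_withDensity_eq_integral_toReal_smul (by fun_prop)
    (Filter.Eventually.of_forall fun y => ENNReal.ofReal_lt_top)]
  refine integral_congr_ae (Filter.Eventually.of_forall fun y => ?_)
  simp only [smul_eq_mul]
  rw [ENNReal.toReal_ofReal (hθ.nonneg y)]

theorem sigmaFinite_markedIntensity (hθ : IsDensity θ) : SigmaFinite (markedIntensity lam θ) := by
  have := hθ.isProbabilityMeasure
  have : SigmaFinite (ENNReal.ofReal lam • (volume : Measure ℝ)) :=
    inferInstanceAs (SigmaFinite (lam.toNNReal • (volume : Measure ℝ)))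
  rw [markedIntensity]
  infer_instance

/-- Tonelli separates times from marks, and translation invariance in time makes the bound
independent of t; it is also uniform over the class. -/
theorem lintegral_abs_noiseKernel_le {K m : ℝ} (hK : 0 ≤ K) (hm : 0 ≤ m) (hθ : IsDensity θ)
    (hKm : ∫⁻ y, ENNReal.ofReal (|y| ^ (4 + m) * θ y) ≤ ENNReal.ofReal K) (t : ℝ) :
    ∫⁻ p, ENNReal.ofReal |noiseKernel α t p| ∂markedIntensity lam θ ≤
      ENNReal.ofReal lam * (∫⁻ s, ENNReal.ofReal (impulseResponse α s)) *
        ENNReal.ofReal (1 + K) := by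
  have := hθ.isProbabilityMeasure
  have hmeas := hθ.measurable
  have himp := measurable_impulseResponse α
  have himp0 : ∀ s, 0 ≤ impulseResponse α s := fun s => by
    unfold impulseResponse
    split_ifs <;> positivity
  have e : ∀ p : ℝ × ℝ, ENNReal.ofReal |noiseKernel α t p| =
      ENNReal.ofReal (impulseResponse α (t - p.1)) * ENNReal.ofReal |p.2| := by
    intro p
    rw [noiseKernel, abs_mul, abs_of_nonneg (himp0 _), mul_comm, ENNReal.ofReal_mul (himp0 _)]
  simp_rw [e]
  rw [markedIntensity, lintegral_prod_mul
    (f := fun τ => ENNReal.ofReal (impulseResponse α (t - τ)))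
    (g := fun y => ENNReal.ofReal |y|) (by fun_prop) (by fun_prop), lintegral_smul_measure,
    lintegral_sub_left_eq_self (fun s => ENNReal.ofReal (impulseResponse α s)) t, smul_eq_mul]
  refine mul_le_mul_right ?_ _
  rw [lintegral_withDensity_eq_lintegral_mul _ (by fun_prop) (by fun_prop)]
  refine le_trans (le_of_eq ?_) (lintegral_abs_mul_density_le hK hm hθ hKm)
  refine lintegral_congr fun y => ?_
  rw [Pi.mul_apply, mul_comm, ENNReal.ofReal_mul (abs_nonneg y)]

theorem lintegral_impulseResponse_lt_top (hα : 0 < α) :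
    ∫⁻ s, ENNReal.ofReal (impulseResponse α s) < ∞ := by
  have h1 : IntegrableOn (fun s => Real.exp (-α * s)) (Set.Ici 0) :=
    (integrableOn_Ici_iff_integrableOn_Ioi).2 (exp_neg_integrableOn_Ioi 0 hα)
  have h2 : Integrable (impulseResponse α) := by
    rw [← integrable_indicator_iff measurableSet_Ici] at h1
    convert! h1 using 1
  exact h2.lintegral_lt_top

/-- The marked points with time in `(a, b]`. -/
def timeStrip (a b : ℝ) : Set (ℝ × ℝ) := Set.Ioc a b ×ˢ Set.univ

theorem measurableSet_timeStrip (a b : ℝ) : MeasurableSet (timeStrip a b) :=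
  measurableSet_Ioc.prod MeasurableSet.univ

theorem markedIntensity_timeStrip (hθ : IsDensity θ) (a b : ℝ) :
    markedIntensity lam θ (timeStrip a b) = ENNReal.ofReal lam * ENNReal.ofReal (b - a) := by
  have := hθ.isProbabilityMeasure
  rw [markedIntensity, timeStrip, Measure.prod_prod, measure_univ, mul_one, Measure.smul_apply,
    Real.volume_Ioc, smul_eq_mul]

/-- The contribution at time `b` of the points with time in `(a, b]`. -/
noncomputable def stripKernel (α a b : ℝ) : ℝ × ℝ → ℝ :=
  (timeStrip a b).indicator (noiseKernel α b)

theorem measurable_stripKernel (α a b : ℝ) : Measurable (stripKernel α a b) :=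
  (measurable_noiseKernel α b).indicator (measurableSet_timeStrip a b)

/-- The substitution y ↦ y - x/e moves the shift from the test function to the density, where it is
magnified by 1/e. -/
theorem integral_mul_shift_sub_le {C γ : ℝ} (hθ : IsDensity θ)
    (hC : ∀ a b : ℝ, ∫ y, |θ (y - a) - θ (y - b)| ≤ C * |a - b| ^ γ) {φ : ℝ → ℝ}
    (hφ : Measurable φ) (h1 : ∀ x, |φ x| ≤ 1) {e : ℝ} (he : 0 < e) (x x' : ℝ) :
    (∫ y, θ y * φ (x + y * e)) - (∫ y, θ y * φ (x' + y * e)) ≤ C * |x / e - x' / e| ^ γ := by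
  have hφe : Measurable fun y => φ (y * e) := by fun_prop
  have hθi : ∀ z, Integrable fun y => θ (y - z) := fun z => hθ.integrable.comp_sub_right z
  have hi : ∀ z, Integrable fun y => θ (y - z) * φ (y * e) := fun z =>
    (hθi z).mul_bdd hφe.aestronglyMeasurable (c := 1) (Filter.Eventually.of_forall fun y => h1 _)
  have hs : ∀ z, ∫ y, θ y * φ (z + y * e) = ∫ y, θ (y - z / e) * φ (y * e) := by
    intro z
    rw [← integral_sub_right_eq_self (fun y => θ y * φ (z + y * e)) (z / e)]
    congr 1 with y
    congr 2
    field_simp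
    ring
  rw [hs, hs, ← integral_sub (hi _) (hi _)]
  refine le_trans (integral_mono ((hi _).sub (hi _)) ((hθi _).sub (hθi _)).abs fun y => ?_)
    (hC (x / e) (x' / e))
  change θ (y - x / e) * φ (y * e) - θ (y - x' / e) * φ (y * e) ≤ |θ (y - x / e) - θ (y - x' / e)|
  rw [← sub_mul]
  refine (le_abs_self _).trans ?_
  rw [abs_mul]
  exact mul_le_of_le_one_right (abs_nonneg _) (h1 _)

/-- Given its time τ, a point contributes a mark scaled by e^{-α(b-τ)} ≥ e^{-α(b-a)}, so shifts are
magnified by at most e^{α(b-a)}. Integrating over τ gives the total mass λ(b - a), which the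
compound Poisson step divides out. -/
theorem hasShiftBound_strip {C γ : ℝ} (hlam : 0 ≤ lam) (hα : 0 ≤ α) (hγ : 0 ≤ γ) (hC0 : 0 ≤ C)
    (hθ : IsDensity θ)
    (hC : ∀ a b : ℝ, ∫ y, |θ (y - a) - θ (y - b)| ≤ C * |a - b| ^ γ) {a b : ℝ} (hab : a ≤ b) :
    HasShiftBound (((markedIntensity lam θ).restrict (timeStrip a b)).map (stripKernel α a b)) 0
      (lam * (b - a) * (C * Real.exp (α * γ * (b - a)))) γ := by
  intro φ hφ h1 x x'
  have := hθ.isProbabilityMeasure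
  have hm := measurable_stripKernel α a b
  set ν := (volume : Measure ℝ).withDensity fun y => ENNReal.ofReal (θ y)
  have hfin : IsFiniteMeasure ((ENNReal.ofReal lam • (volume : Measure ℝ)).restrict
      (Set.Ioc a b)) := by
    refine ⟨?_⟩
    rw [Measure.restrict_apply_univ, Measure.smul_apply, Real.volume_Ioc, smul_eq_mul]
    exact ENNReal.mul_lt_top ENNReal.ofReal_lt_top ENNReal.ofReal_lt_top
  have hres : (markedIntensity lam θ).restrict (timeStrip a b) =
      ((ENNReal.ofReal lam • (volume : Measure ℝ)).restrict (Set.Ioc a b)).prod ν := by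
    rw [markedIntensity, timeStrip, ← Measure.prod_restrict, Measure.restrict_univ]
  have hφm : ∀ z, Measurable fun p : ℝ × ℝ => φ (z + stripKernel α a b p) := fun z => by fun_prop
  have e : ∀ z, ∫ v, φ (z + v) ∂((markedIntensity lam θ).restrict (timeStrip a b)).map
      (stripKernel α a b) = ∫ τ in Set.Ioc a b, ∫ y, φ (z + stripKernel α a b (τ, y)) ∂ν
        ∂(ENNReal.ofReal lam • (volume : Measure ℝ)) := by
    intro z
    rw [integral_map hm.aemeasurable (Measurable.aestronglyMeasurable (by fun_prop)), hres,
      integral_prod _ (integrable_of_abs_le_one (hφm z) fun _ => h1 _)]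
  have hi : ∀ z, Integrable (fun τ => ∫ y, φ (z + stripKernel α a b (τ, y)) ∂ν)
      ((ENNReal.ofReal lam • (volume : Measure ℝ)).restrict (Set.Ioc a b)) := fun z =>
    (integrable_of_abs_le_one (hφm z) fun _ => h1 _).integral_prod_left
  rw [e, e, ← integral_sub (hi x) (hi x'), zero_add]
  calc ∫ τ in Set.Ioc a b, (∫ y, φ (x + stripKernel α a b (τ, y)) ∂ν -
          ∫ y, φ (x' + stripKernel α a b (τ, y)) ∂ν) ∂(ENNReal.ofReal lam • (volume : Measure ℝ))
      ≤ ∫ _τ in Set.Ioc a b, C * Real.exp (α * γ * (b - a)) * |x - x'| ^ γ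
          ∂(ENNReal.ofReal lam • (volume : Measure ℝ)) := by
        refine setIntegral_mono_on ((hi x).sub (hi x')) (integrable_const _) measurableSet_Ioc
          fun τ hτ => ?_
        have hk : ∀ y, stripKernel α a b (τ, y) = y * Real.exp (-α * (b - τ)) := fun y => by
          rw [stripKernel, Set.indicator_of_mem
            (show (τ, y) ∈ timeStrip a b from Set.mk_mem_prod hτ (Set.mem_univ y)),
            noiseKernel_of_le hτ.2]
        simp_rw [hk, ν, hθ.integral_withDensity]
        refine (integral_mul_shift_sub_le hθ hC hφ h1 (Real.exp_pos _) x x').trans ?_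
        rw [mul_assoc]
        refine mul_le_mul_of_nonneg_left ?_ hC0
        rw [← sub_div, abs_div, abs_of_pos (Real.exp_pos _), div_eq_inv_mul, ← Real.exp_neg,
          Real.mul_rpow (Real.exp_pos _).le (abs_nonneg _), ← Real.exp_mul]
        refine mul_le_mul_of_nonneg_right (Real.exp_le_exp.2 ?_) (by positivity)
        have h2 : b - τ ≤ b - a := by linarith [hτ.1]
        calc -(-α * (b - τ)) * γ = α * γ * (b - τ) := by ring
          _ ≤ _ := mul_le_mul_of_nonneg_left h2 (by positivity)
    _ = _ := by
        rw [integral_const, smul_eq_mul, measureReal_restrict_apply_univ, measureReal_ennreal_smul_apply,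
          ENNReal.toReal_ofReal hlam, Real.volume_real_Ioc_of_le hab]
        ring

end Intensity


/-! ### Splitting the shot noise across a time gap, and the mixing estimate -/

section Mixing

variable {Ω : Type*} [MeasurableSpace Ω] {P : Measure Ω}
  {lam α : ℝ} {θ : ℝ → ℝ} {Z : ℤ → Ω → ℝ × ℝ}

theorem hasShiftBound_map_tsum_stripKernel [IsProbabilityMeasure P] {C γ : ℝ} (hlam : 0 ≤ lam) (hα : 0 ≤ α) (hγ : 0 ≤ γ)
    (hC0 : 0 ≤ C) (hθ : IsDensity θ)
    (hC : ∀ a b : ℝ, ∫ y, |θ (y - a) - θ (y - b)| ≤ C * |a - b| ^ γ)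
    (hZ : IsPoissonPointProcess P Z (markedIntensity lam θ)) {a b : ℝ} (hab : a ≤ b) :
    HasShiftBound (P.map fun ω => ∑' k, stripKernel α a b (Z k ω))
      (2 * Real.exp (-(lam * (b - a)))) (C * Real.exp (α * γ * (b - a))) γ := by
  have hfm := measurable_stripKernel α a b
  have hA := measurableSet_timeStrip a b
  have hμ := markedIntensity_timeStrip (lam := lam) hθ a b
  rw [← ENNReal.ofReal_mul hlam] at hμ
  have hμt : markedIntensity lam θ (timeStrip a b) < ∞ := hμ ▸ ENNReal.ofReal_lt_top
  have : Fact (markedIntensity lam θ (timeStrip a b) < ∞) := ⟨hμt⟩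
  have hf0 : ∀ x ∉ timeStrip a b, stripKernel α a b x = 0 := fun x hx =>
    Set.indicator_of_notMem hx _
  have hVm : Measurable fun ω => ∑' k, stripKernel α a b (Z k ω) :=
    (measurable_regionSigma_tsum Z hA hfm hf0).mono (regionSigma_le hZ.measurable _) le_rfl
  have : IsProbabilityMeasure (P.map fun ω => ∑' k, stripKernel α a b (Z k ω)) :=
    Measure.isProbabilityMeasure_map hVm.aemeasurable
  let m := ((markedIntensity lam θ).restrict (timeStrip a b)).map (stripKernel α a b)
  have hmass : m.real Set.univ = lam * (b - a) := by
    rw [map_measureReal_apply hfm MeasurableSet.univ, Set.preimage_univ,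
      measureReal_restrict_apply_univ, measureReal_def, hμ,
      ENNReal.toReal_ofReal (mul_nonneg hlam (by linarith))]
  -- The Lévy measure is the image under the kernel of the intensity on the strip, so its mass is
  -- λ(b - a).
  have hlaw := eq_compound_of_charFun m (κ := P.map fun ω => ∑' k, stripKernel α a b (Z k ω))
    fun u => by
      rw [hZ.charFun_tsum hA hμt hfm hf0, charFun_apply_real,
        integral_map hfm.aemeasurable (Measurable.aestronglyMeasurable (by fun_prop)),
        integral_sub _ (integrable_const _)]
      · rw [integral_const, measureReal_restrict_apply_univ]
        congr 2
        rw [map_measureReal_apply hfm MeasurableSet.univ, Set.preimage_univ,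
          measureReal_restrict_apply_univ]
        simp
      · refine Integrable.of_bound (Measurable.aestronglyMeasurable (by fun_prop)) 1
          (Filter.Eventually.of_forall fun x => ?_)
        rw [← Complex.ofReal_mul, Complex.norm_exp_ofReal_mul_I]
  rw [hlaw, ← hmass]
  refine hasShiftBound_compound m (by positivity) ?_
  have := hasShiftBound_strip hlam hα hγ hC0 hθ hC hab
  rw [hmass]
  exact this

/-- The marked points with time after `t` but outside `(a, b]`. -/
def timeRest (t a b : ℝ) : Set (ℝ × ℝ) := (Set.Ioi t \ Set.Ioc a b) ×ˢ Set.univ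

theorem measurableSet_timeRest (t a b : ℝ) : MeasurableSet (timeRest t a b) :=
  (measurableSet_Ioi.diff measurableSet_Ioc).prod MeasurableSet.univ

/-- The contribution at time `s` of the points with time after `t` but outside `(a, b]`. -/
noncomputable def restKernel (α t a b s : ℝ) : ℝ × ℝ → ℝ :=
  (timeRest t a b).indicator (noiseKernel α s)

theorem measurable_restKernel (α t a b s : ℝ) : Measurable (restKernel α t a b s) :=
  (measurable_noiseKernel α s).indicator (measurableSet_timeRest t a b)

/-- A point lies before t, in (a, b], or in the rest. In the first two cases the exponential kernel
factors through the elapsed time, which is special to this impulse response. -/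
theorem noiseKernel_decomp {t a b d : ℝ} (hta : t ≤ a) (hab : a ≤ b) (hd : 0 ≤ d) (p : ℝ × ℝ) :
    noiseKernel α (b + d) p =
      Real.exp (-α * d) * (Real.exp (-α * (b - t)) * noiseKernel α t p + stripKernel α a b p) +
        restKernel α t a b (b + d) p := by
  have hstrip : p ∈ timeStrip a b ↔ a < p.1 ∧ p.1 ≤ b := by simp [timeStrip]
  have hrest : p ∈ timeRest t a b ↔ t < p.1 ∧ (a < p.1 → b < p.1) := by simp [timeRest]
  rcases le_or_gt p.1 t with h | h
  · rw [stripKernel, Set.indicator_of_notMem (by rw [hstrip]; intro h'; linarith [h'.1]),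
      restKernel, Set.indicator_of_notMem (by rw [hrest]; intro h'; linarith [h'.1]),
      show b + d = t + ((b - t) + d) by ring, noiseKernel_add (by linarith) h, mul_add,
      Real.exp_add]
    ring
  · rw [noiseKernel_of_lt h]
    by_cases hs : a < p.1 ∧ p.1 ≤ b
    · rw [stripKernel, Set.indicator_of_mem (hstrip.2 hs), restKernel,
        Set.indicator_of_notMem (by rw [hrest]; intro h'; linarith [h'.2 hs.1]),
        noiseKernel_add hd hs.2]
      ring
    · rw [stripKernel, Set.indicator_of_notMem (by rwa [hstrip]), restKernel,
        Set.indicator_of_mem (hrest.2 ⟨h, fun h' => by by_contra h2; exact hs ⟨h', by linarith⟩⟩)]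
      ring

theorem abs_indicator_le (s : Set (ℝ × ℝ)) (f : ℝ × ℝ → ℝ) (p : ℝ × ℝ) :
    |s.indicator f p| ≤ |f p| := by
  by_cases h : p ∈ s <;> simp [h]

theorem IsPoissonPointProcess.ae_tsum_noiseKernel_eq
    (hZ : IsPoissonPointProcess P Z (markedIntensity lam θ)) (hθ : IsDensity θ)
    (hint : ∀ s, ∫⁻ p, ENNReal.ofReal |noiseKernel α s p| ∂markedIntensity lam θ < ∞)
    {t a b d : ℝ} (hta : t ≤ a) (hab : a ≤ b) (hd : 0 ≤ d) :
    ∀ᵐ ω ∂P, ∑' k, noiseKernel α (b + d) (Z k ω) =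
      Real.exp (-α * d) * (Real.exp (-α * (b - t)) * ∑' k, noiseKernel α t (Z k ω) +
        ∑' k, stripKernel α a b (Z k ω)) + ∑' k, restKernel α t a b (b + d) (Z k ω) := by
  have := sigmaFinite_markedIntensity (lam := lam) hθ
  filter_upwards [hZ.ae_summable (measurable_noiseKernel α t) (hint t),
    hZ.ae_summable (measurable_stripKernel α a b) ((lintegral_mono fun p =>
      ENNReal.ofReal_le_ofReal (abs_indicator_le _ _ p)).trans_lt (hint b)),
    hZ.ae_summable (measurable_restKernel α t a b (b + d)) ((lintegral_mono fun p =>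
      ENNReal.ofReal_le_ofReal (abs_indicator_le _ _ p)).trans_lt (hint (b + d)))]
    with ω h1 h2 h3
  simp_rw [noiseKernel_decomp hta hab hd]
  rw [(((h1.mul_left _).add h2).mul_left _).tsum_add h3, tsum_mul_left,
    (h1.mul_left _).tsum_add h2, tsum_mul_left]

/-- From |x|^γ ≤ 1 + |x| for 0 < γ ≤ 1, so a first moment suffices while the contraction r keeps its
power γ. -/
theorem integral_abs_sub_rpow_le [IsProbabilityMeasure P]
    {W : Ω → ℝ} (hW : Measurable W) {a b γ M r : ℝ} (hb : 0 ≤ b)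
    (hγ : 0 < γ) (hγ1 : γ ≤ 1) (hM : 0 ≤ M) (hr : 0 ≤ r)
    (hWM : ∫⁻ ω, ENNReal.ofReal |W ω| ∂P ≤ ENNReal.ofReal M) :
    Integrable (fun z : Ω × Ω => a + b * |r * W z.1 - r * W z.2| ^ γ) (P.prod P) ∧
      ∫ z : Ω × Ω, (a + b * |r * W z.1 - r * W z.2| ^ γ) ∂(P.prod P) ≤
        a + b * r ^ γ * (1 + 2 * M) := by
  have hWi : Integrable (fun ω => |W ω|) P :=
    ⟨by fun_prop, by
      rw [hasFiniteIntegral_iff_ofReal (Filter.Eventually.of_forall fun _ => abs_nonneg _)]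
      exact hWM.trans_lt ENNReal.ofReal_lt_top⟩
  have hWI : ∫ ω, |W ω| ∂P ≤ M := by
    rw [integral_eq_lintegral_of_nonneg_ae (Filter.Eventually.of_forall fun _ => abs_nonneg _)
      hWi.aestronglyMeasurable]
    exact ENNReal.toReal_le_of_le_ofReal hM hWM
  have h1 : Integrable (fun z : Ω × Ω => |W z.1|) (P.prod P) := hWi.comp_fst P
  have h2 : Integrable (fun z : Ω × Ω => |W z.2|) (P.prod P) := hWi.comp_snd P
  have h12 : Integrable (fun z : Ω × Ω => |W z.1| + |W z.2|) (P.prod P) := h1.add h2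
  have hdom : Integrable (fun z : Ω × Ω => b * r ^ γ * (1 + (|W z.1| + |W z.2|))) (P.prod P) :=
    ((integrable_const 1).add h12).const_mul _
  have hle : ∀ z : Ω × Ω, b * |r * W z.1 - r * W z.2| ^ γ ≤
      b * r ^ γ * (1 + (|W z.1| + |W z.2|)) := by
    intro z
    rw [← mul_sub, abs_mul, abs_of_nonneg hr, Real.mul_rpow hr (abs_nonneg _), mul_assoc]
    have h3 : |W z.1 - W z.2| ≤ |W z.1| + |W z.2| := abs_sub _ _
    have h4 : |W z.1 - W z.2| ^ γ ≤ 1 + (|W z.1| + |W z.2|) := by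
      rcases le_total |W z.1 - W z.2| 1 with h | h
      · have := Real.rpow_le_one (abs_nonneg _) h hγ.le
        linarith [abs_nonneg (W z.1), abs_nonneg (W z.2)]
      · have := Real.rpow_le_rpow_of_exponent_le h hγ1
        rw [Real.rpow_one] at this
        linarith
    gcongr
  have hi : Integrable (fun z : Ω × Ω => b * |r * W z.1 - r * W z.2| ^ γ) (P.prod P) := by
    refine hdom.mono' (Measurable.aestronglyMeasurable (by fun_prop))
      (Filter.Eventually.of_forall fun z => ?_)
    rw [Real.norm_of_nonneg (by positivity)]
    exact hle z
  refine ⟨(integrable_const a).add hi, ?_⟩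
  rw [integral_add (integrable_const a) hi, integral_const, probReal_univ, one_smul]
  have e : ∫ z : Ω × Ω, b * r ^ γ * (1 + (|W z.1| + |W z.2|)) ∂(P.prod P) =
      b * r ^ γ * (1 + (∫ ω, |W ω| ∂P + ∫ ω, |W ω| ∂P)) := by
    rw [integral_const_mul, integral_add (integrable_const 1) h12, integral_add h1 h2,
      integral_fun_fst (fun ω => |W ω|), integral_fun_snd (fun ω => |W ω|)]
    simp
  have h5 := (integral_mono hi hdom hle).trans_eq e
  have h6 : b * r ^ γ * (1 + (∫ ω, |W ω| ∂P + ∫ ω, |W ω| ∂P)) ≤ b * r ^ γ * (1 + 2 * M) := by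
    gcongr
    linarith
  linarith

/-- Doob–Dynkin factorisation through a countable enumeration of the relevant coordinates. -/
theorem measurable_iSup_comap {ι : Type*} {Ω : Type*} {q : ℕ} (p : ι → Prop) (X : ι → Ω → ℝ)
    (σ : ℕ → ι) (hσ : ∀ i, p i → ∃ j, σ j = i) {J : Ω → Fin q} [Nonempty (Fin q)]
    (hJ : Measurable[⨆ (i : ι) (_ : p i), MeasurableSpace.comap (X i) inferInstance] J) :
    ∃ G : (ℕ → ℝ) → Fin q, Measurable G ∧ ∀ ω, J ω = G fun j => X (σ j) ω := by
  have hle : (⨆ (i : ι) (_ : p i), MeasurableSpace.comap (X i) inferInstance) ≤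
      MeasurableSpace.comap (fun ω (j : ℕ) => X (σ j) ω) MeasurableSpace.pi := by
    refine iSup₂_le fun i hi => ?_
    obtain ⟨j, rfl⟩ := hσ i hi
    refine Measurable.comap_le ?_
    have h := comap_measurable (m := MeasurableSpace.pi) fun ω (j : ℕ) => X (σ j) ω
    exact (measurable_pi_apply j).comp h
  obtain ⟨G, hG, hJG⟩ := (hJ.mono hle le_rfl).exists_eq_measurable_comp
  exact ⟨G, hG, fun ω => congrFun hJG ω⟩

theorem sum_abs_sub_mul_shotNoise_le [IsProbabilityMeasure P] {C γ M : ℝ} (hlam : 0 ≤ lam) (hα : 0 ≤ α) (hγ : 0 < γ)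
    (hγ1 : γ ≤ 1) (hC0 : 0 ≤ C) (hM : 0 ≤ M) (hθ : IsDensity θ)
    (hC : ∀ a b : ℝ, ∫ y, |θ (y - a) - θ (y - b)| ≤ C * |a - b| ^ γ)
    (hint : ∀ s, ∫⁻ p, ENNReal.ofReal |noiseKernel α s p| ∂markedIntensity lam θ ≤
      ENNReal.ofReal M)
    (hZ : IsPoissonPointProcess P Z (markedIntensity lam θ)) (n t : ℕ) {p q : ℕ}
    {I : Ω → Fin p} {J : Ω → Fin q}
    (hI : Measurable[regionSigma Z (Set.Iic (t : ℝ) ×ˢ Set.univ)] I)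
    {G : (ℕ → ℝ) → Fin q} (hG : Measurable G)
    (hJ : ∀ ω, J ω = G fun j => ∑' k, noiseKernel α ((t : ℝ) + n + j) (Z k ω)) :
    ∑ i, ∑ j, |P.real (I ⁻¹' {i} ∩ J ⁻¹' {j}) - P.real (I ⁻¹' {i}) * P.real (J ⁻¹' {j})| ≤
      2 * Real.exp (-(lam * (n / 2))) + C * (1 + 2 * M) * Real.exp (-(α * γ * (n / 2))) := by
  have := sigmaFinite_markedIntensity (lam := lam) hθ
  -- Half of the gap is left out of the window: over the whole gap the magnification e^{αγn} would
  -- cancel the contraction e^{-αγn}.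
  set a : ℝ := t + n / 2 with ha
  set b : ℝ := t + n with hb
  have hn : (0 : ℝ) ≤ n := n.cast_nonneg
  have hta : (t : ℝ) ≤ a := by rw [ha]; linarith
  have hab : a ≤ b := by rw [ha, hb]; linarith
  have hba : b - a = n / 2 := by rw [ha, hb]; ring
  have hbt : b - t = n := by rw [hb]; ring
  let past : Set (ℝ × ℝ) := Set.Iic (t : ℝ) ×ˢ Set.univ
  have hpast : MeasurableSet past := measurableSet_Iic.prod MeasurableSet.univ
  have hS := measurableSet_timeStrip a b
  have hR := measurableSet_timeRest t a b
  let W₀ : Ω → ℝ := fun ω => ∑' k, noiseKernel α t (Z k ω)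
  let V : Ω → ℝ := fun ω => ∑' k, stripKernel α a b (Z k ω)
  let H : Ω → ℕ → ℝ := fun ω j => ∑' k, restKernel α t a b (b + j) (Z k ω)
  have hle := fun R => regionSigma_le hZ.measurable R
  have hW₀ : Measurable[regionSigma Z past] W₀ :=
    measurable_regionSigma_tsum Z hpast (measurable_noiseKernel α t) fun x hx =>
      noiseKernel_of_lt (by simpa [past] using hx)
  have hV : Measurable[regionSigma Z (timeStrip a b)] V :=
    measurable_regionSigma_tsum Z hS (measurable_stripKernel α a b) fun x hx =>
      Set.indicator_of_notMem hx _
  have hH : Measurable[regionSigma Z (timeRest t a b)] H :=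
    @measurable_pi_lambda _ _ _ (regionSigma Z (timeRest t a b)) _ _ fun j =>
      measurable_regionSigma_tsum Z hR (measurable_restKernel α t a b _) fun x hx =>
        Set.indicator_of_notMem hx _
  have hr : Measurable fun x : ℝ => Real.exp (-α * (b - t)) * x := by fun_prop
  have hW : Measurable[regionSigma Z past] fun ω => Real.exp (-α * (b - t)) * W₀ ω := hr.comp hW₀
  have hIW : Measurable[regionSigma Z past] fun ω => (I ω, Real.exp (-α * (b - t)) * W₀ ω) :=
    hI.prodMk hW
  have hVH : Measurable[regionSigma Z pastᶜ] fun ω => (V ω, H ω) := by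
    refine (hV.mono (regionSigma_mono Z fun x hx => ?_) le_rfl).prodMk
      (hH.mono (regionSigma_mono Z fun x hx => ?_) le_rfl)
    · have : a < x.1 := hx.1.1
      simp [past]
      linarith
    · have : (t : ℝ) < x.1 := hx.1.1
      simpa [past] using this
  have hind : IndepFun (fun ω => (I ω, Real.exp (-α * (b - t)) * W₀ ω)) (fun ω => (V ω, H ω)) P :=
    (IndepFun_iff_Indep _ _ _).2 (indep_of_indep_of_le_left (indep_of_indep_of_le_right
      (hZ.indep_regionSigma hpast hpast.compl disjoint_compl_right) hVH.comap_le) hIW.comap_le)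
  have hdisj : Disjoint (timeStrip a b) (timeRest t a b) :=
    Set.disjoint_left.2 fun x hx hx' => hx'.1.2 hx.1
  have hindVH : IndepFun V H P :=
    (IndepFun_iff_Indep _ _ _).2 (indep_of_indep_of_le_left (indep_of_indep_of_le_right
      (hZ.indep_regionSigma hS hR hdisj) hH.comap_le) hV.comap_le)
  have hV' : Measurable V := hV.mono (hle _) le_rfl
  have hH' : Measurable H := hH.mono (hle _) le_rfl
  have hW₀' : Measurable W₀ := hW₀.mono (hle _) le_rfl
  -- Rebuilds the whole future sequence from the single number e^{-α(b-t)} X_t + V and the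
  -- independent remainders H.
  let G' : ℝ × (ℕ → ℝ) → Fin q := fun z => G fun j => Real.exp (-α * j) * z.1 + z.2 j
  have hG' : Measurable G' := hG.comp (by fun_prop)
  have hJ' : ∀ᵐ ω ∂P, J ω = G' (Real.exp (-α * (b - t)) * W₀ ω + V ω, H ω) := by
    have hall := ae_all_iff.2 fun j : ℕ => hZ.ae_tsum_noiseKernel_eq hθ
      (fun s => (hint s).trans_lt ENNReal.ofReal_lt_top) hta hab (d := j) j.cast_nonneg
    filter_upwards [hall] with ω hω
    rw [hJ ω]
    congr 1
    ext j
    exact hω j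
  have hJm : Measurable J := by
    have hX : Measurable fun ω => fun j : ℕ => ∑' k, noiseKernel α (b + j) (Z k ω) :=
      measurable_pi_lambda _ fun j => (measurable_regionSigma_tsum Z MeasurableSet.univ
        (measurable_noiseKernel α _) fun x hx => (hx trivial).elim).mono (hle _) le_rfl
    rw [funext hJ]
    exact hG.comp hX
  have hshift := hasShiftBound_map_tsum_stripKernel hlam hα hγ.le hC0 hθ hC hZ hab
  obtain ⟨hi, hbound⟩ := integral_abs_sub_rpow_le (P := P) hW₀'
    (a := 2 * Real.exp (-(lam * (b - a)))) (b := C * Real.exp (α * γ * (b - a)))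
    (r := Real.exp (-α * (b - t))) (by positivity) hγ hγ1 hM (Real.exp_pos _).le
    ((hZ.lintegral_abs_tsum_le (measurable_noiseKernel α t)).trans (hint t))
  refine (sum_abs_sub_mul_le (hI.mono (hle _) le_rfl) hJm (hW.mono (hle _) le_rfl) hV' hH' hind
    hindVH hG' hJ' hshift hi).trans (hbound.trans_eq ?_)
  -- Magnification e^{αγn/2} times contraction e^{-αγn} leaves e^{-αγn/2}.
  rw [hba, hbt, ← Real.exp_mul, mul_assoc C, ← Real.exp_add,
    show α * γ * (n / 2) + -α * n * γ = -(α * γ * (n / 2)) by ring]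
  ring

end Mixing

end ShotNoise

/-! ### The uniform exponential bound -/

theorem theorem4p2 (lam α K L s m : ℝ) (hlam : 0 < lam) (hα : 0 < α)
    (hK : 0 < K) (hL : 0 < L) (hm : 0 < m) (hs : 1 / 2 < s) :
    ∃ C ρ : ℝ, 0 < C ∧ 0 < ρ ∧ ρ < 1 ∧
      ∀ n : ℕ, 1 ≤ n →
      ∀ θ ∈ ShotNoise.smoothnessClass K L s m,
      ∀ (Ω : Type u) [MeasurableSpace Ω] (P : Measure Ω) [IsProbabilityMeasure P]
        (T Y : ℤ → Ω → ℝ),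
        ShotNoise.IsPoissonPointProcess P (fun k ω => (T k ω, Y k ω))
          (ShotNoise.markedIntensity lam θ) →
        ShotNoise.betaMixing P (fun i : ℕ => ShotNoise.shotNoise α T Y (i : ℝ)) n
          ≤ ENNReal.ofReal (C * ρ ^ n) := by
  open ShotNoise in
  obtain ⟨C, γ, hC, hγ, hγ1, htrans⟩ := exists_translate_bound (L := L) hK.le hm.le hs
  set Q := ∫⁻ s, ENNReal.ofReal (impulseResponse α s)
  have hQ : Q < ∞ := lintegral_impulseResponse_lt_top hα
  set M := lam * Q.toReal * (1 + K) with hMdef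
  have hM : 0 ≤ M := by positivity
  have hMeq : ENNReal.ofReal lam * Q * ENNReal.ofReal (1 + K) = ENNReal.ofReal M := by
    rw [hMdef, ENNReal.ofReal_mul (by positivity), ENNReal.ofReal_mul hlam.le,
      ENNReal.ofReal_toReal hQ.ne]
  -- The slower of the two rates: an empty window, and loss of memory of X_t.
  have hδ : 0 < min (lam / 2) (α * γ / 2) := lt_min (by positivity) (by positivity)
  set δ := min (lam / 2) (α * γ / 2)
  refine ⟨2 + C * (1 + 2 * M), Real.exp (-δ), by positivity, Real.exp_pos _,
    Real.exp_lt_one_iff.2 (by linarith), fun n _ θ hθ Ω _ P _ T Y hZ => ?_⟩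
  obtain ⟨hdens, hKm, -⟩ := id hθ
  have hint : ∀ t, ∫⁻ p, ENNReal.ofReal |noiseKernel α t p| ∂markedIntensity lam θ ≤
      ENNReal.ofReal M := fun t =>
    (lintegral_abs_noiseKernel_le hK.le hm.le hdens hKm t).trans_eq hMeq
  refine iSup_le fun t => ?_
  rw [betaCoeff]
  -- The factor ½ in β is simply bounded by 1.
  refine (mul_le_mul_right (iSup_le fun p => iSup_le fun q => iSup_le fun A => iSup_le fun B =>
    iSup_le fun hA => iSup_le fun hB => ?_) _).trans
    (mul_le_of_le_one_left' (show (2 : ℝ≥0∞)⁻¹ ≤ 1 by simp))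
  obtain ⟨I, hI, hAI⟩ := hA.exists_index
  obtain ⟨J, hJ, hBJ⟩ := hB.exists_index
  -- The case q = 0 is excluded because a probability space is nonempty; the factorisation needs a
  -- default value.
  have hne : Nonempty (Fin q) := ⟨J (nonempty_of_isProbabilityMeasure P).some⟩
  obtain ⟨G, hG, hJG⟩ := measurable_iSup_comap (fun u : ℕ => t ≤ u)
    (fun u : ℕ => shotNoise α T Y ((n + u : ℕ) : ℝ)) (fun j => t + j)
    (fun u hu => ⟨u - t, by omega⟩) hJ
  have hI' : Measurable[regionSigma (fun k ω => (T k ω, Y k ω))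
      (Set.Iic (t : ℝ) ×ˢ Set.univ)] I := by
    refine hI.mono (iSup₂_le fun u hu => Measurable.comap_le ?_) le_rfl
    have hut : (u : ℝ) ≤ t := by exact_mod_cast hu
    refine Eq.mpr (congrArg _ (funext (shotNoise_eq_tsum α T Y u))) ?_
    refine measurable_regionSigma_tsum _ (measurableSet_Iic.prod MeasurableSet.univ)
      (measurable_noiseKernel α u) fun x hx => noiseKernel_of_lt ?_
    have : (t : ℝ) < x.1 := by simpa using hx
    linarith
  have hJ' : ∀ ω, J ω = G fun j => ∑' k, noiseKernel α ((t : ℝ) + n + j) (T k ω, Y k ω) := by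
    intro ω
    rw [hJG ω]
    congr 1
    ext j
    rw [shotNoise_eq_tsum]
    congr! 3
    push_cast
    ring
  have hmain := sum_abs_sub_mul_shotNoise_le hlam.le hα.le hγ hγ1 hC.le hM hdens
    (htrans θ hθ) hint hZ n t hI' hG hJ'
  have hsum : ∑ i, ∑ j, ENNReal.ofReal |P.real (A i ∩ B j) - P.real (A i) * P.real (B j)| =
      ENNReal.ofReal (∑ i, ∑ j,
        |P.real (I ⁻¹' {i} ∩ J ⁻¹' {j}) - P.real (I ⁻¹' {i}) * P.real (J ⁻¹' {j})|) := by
    rw [ENNReal.ofReal_sum_of_nonneg fun i _ => Finset.sum_nonneg fun j _ => abs_nonneg _]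
    refine Finset.sum_congr rfl fun i _ => ?_
    rw [ENNReal.ofReal_sum_of_nonneg fun j _ => abs_nonneg _]
    simp_rw [hAI, hBJ]
  rw [hsum]
  refine ENNReal.ofReal_le_ofReal (hmain.trans ?_)
  rw [← Real.exp_nat_mul, add_mul]
  have hn : (0 : ℝ) ≤ n := n.cast_nonneg
  have h1 : (n : ℝ) * δ ≤ n * (lam / 2) := mul_le_mul_of_nonneg_left (min_le_left _ _) hn
  have h2 : (n : ℝ) * δ ≤ n * (α * γ / 2) := mul_le_mul_of_nonneg_left (min_le_right _ _) hn
  gcongr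
  · linarith
  · linarith
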